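/- **Setting.** Let $\mu>0$, $R_\oplus>0$. Use the Delaunay canonical variables $(\ell,g,h,L,G,H)$ in the domain $0<G<L$, $|H|<G$, and set $a=L^2/\mu$, $n=\mu^2/L^3$, $e=(1-G^2/L^2)^{1/2}$, $\eta=(1-e^2)^{1/2}=G/L$, $p=a\eta^2$, $s=\sin I$ with $\cos I=H/G$. Let $f$ be the true anomaly, a function of $e$ and $\ell$ through Kepler's equation $E-e\sin E=\ell$ (continuous branch, $f=0$ at $\ell=0$), $\phi=f-\ell$, and $r=p/(1+e\cos f)$. The Poisson bracket is $\{A,B\}=\sum_{(q,P)}\big(\partial_qA\,\partial_PB-\partial_PA\,\partial_qB\big)$ over the pairs $(\ell,L),(g,G),(h,H)$, and $\langle F\rangle_\ell=\frac1{2\pi}\int_0^{2\pi}F\,\mathrm d\ell$. For an integer $m$ write $m^\star=m\bmod 2$. Assume $5s^2\neq4$. Consider the main problem $-\frac{\mu}{2a}+J_2\mathcal H_{1,0}$ with $$\mathcal H_{1,0}=-\frac{\mu}{r}\frac{R_\oplus^2}{r^2}\frac12\Big[1-\tfrac32s^2+\tfrac32s^2\cos(2f+2g)\Big],$$ and the single-transformation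 (complete) normalization $$\mathcal H_{0,1}=\langle\mathcal H_{1,0}\rangle_\ell,\qquad \mathcal W_1=-G\frac{R_\oplus^2}{p^2}\frac12\bigg[B_0\phi+\sum_{i=0}^1B_i\sum_{j=\max(i,1)}^{2i+1}\frac{(2-j^\star)^i}{j}e^{|j-2i|}\sin(jf+2ig)\bigg]+\mathcal C_1,$$ $$\mathcal C_1=G\frac{R_\oplus^2}{p^2}\frac{15s^2-14}{32(5s^2-4)}s^2e^2\sin2g,\qquad B_0=1-\tfrac32s^2,\quad B_1=\tfrac34s^2,$$ $$\widetilde{\mathcal H}_{0,2}=\{\mathcal H_{1,0},\mathcal W_1\}+\{\mathcal H_{0,1},\mathcal W_1\},\qquad \mathcal H_{0,2}=\langle\widetilde{\mathcal H}_{0,2}\rangle_\ell,\qquad \mathcal W_2=\frac1n\int_0^{\ell}(\widetilde{\mathcal H}_{0,2}-\mathcal H_{0,2})\,\mathrm d\ell+\mathcal C_2,$$ where $\mathcal C_2$ is any function of the Delaunay variables that does not depend on $\ell$. **Claim.** The determining function solves the homological equations $$n\,\partial_\ell\mathcal W_1=\mathcal H_{1,0}-\mathcal H_{0,1},\qquad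 n\,\partial_\ell\mathcal W_2=\widetilde{\mathcal H}_{0,2}-\mathcal H_{0,2};$$ with $\Delta a=\{a,\mathcal W_1\}$, the functions $\mathcal W_1$ and $\Delta a$ have all their first partial derivatives; and the inverse second-order periodic correction to the semi-major axis, $\delta a=\{\Delta a,\mathcal W_1\}-\{a,\mathcal W_2\}$, is $$\delta a=a\frac{R_\oplus^4}{p^4}\frac1{4^4\eta^4}\bigg[24\eta^7(5s^4+8s^2-8)+48\eta^5(15s^2-14)s^2e^2\cos2g$$ $$\qquad+\sum_{i=0}^2\ \sum_{j=-i-3i^\star}^{6+2i}\ \sum_{k=0}^{6-|j-2i|}(3s^2-2)^{i^\star}s^{2i}A_{i,j,k}(s)\,\eta^ke^{|j-2i|}\cos(jf+2ig)\bigg].$$ The coefficients $A_{i,j,k}$ are as follows; those not listed are zero, and for $i=1$ the product $(3s^2-2)A_{1,j,k}$ is understood as a polynomial, the divisor $3s^2-2$ being cancelled. *$i=0$*, with $P=2(27s^4-24s^2+8)$ and $Q=-16(3s^2-2)^2$: - $A_{0,0,0}=462P$, $A_{0,0,2}=-630P$, $A_{0,0,3}=10Q$, $A_{0,0,4}=210P$,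 $A_{0,0,5}=24(71s^4-128s^2+56)$, $A_{0,0,6}=-4(63s^4-24s^2+8)$; - $A_{0,1,0}=792P$, $A_{0,1,2}=-720P$, $A_{0,1,3}=15Q$, $A_{0,1,4}=120P$, $A_{0,1,5}=-3Q$; - $A_{0,2,0}=495P$, $A_{0,2,2}=-270P$, $A_{0,2,3}=6Q$, $A_{0,2,4}=15P$; - $A_{0,3,0}=220P$, $A_{0,3,2}=-60P$, $A_{0,3,3}=Q$; $A_{0,4,0}=66P$, $A_{0,4,2}=-6P$; $A_{0,5,0}=12P$; $A_{0,6,0}=P$. *$i=1$*: - $A_{1,-4,0}=A_{1,8,0}=-12$; $A_{1,-3,0}=A_{1,7,0}=-144$; $A_{1,-2,0}=A_{1,6,0}=-792$, $A_{1,-2,2}=A_{1,6,2}=72$; - $A_{1,-1,0}=A_{1,5,0}=-2640$, $A_{1,-1,2}=A_{1,5,2}=720$, $A_{1,-1,3}=A_{1,5,3}=24$; - $A_{1,0,0}=A_{1,4,0}=-5940$, $A_{1,0,2}=A_{1,4,2}=3240$, $A_{1,0,3}=A_{1,4,3}=144$, $A_{1,0,4}=A_{1,4,4}=-180$; - $A_{1,1,0}=A_{1,3,0}=-9504$,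 $A_{1,1,2}=A_{1,3,2}=8640$, $A_{1,1,3}=A_{1,3,3}=360$, $A_{1,1,4}=A_{1,3,4}=-1440$, $A_{1,1,5}=-\frac{72(43s^2-34)}{3s^2-2}$, $A_{1,3,5}=-\frac{24(49s^2-38)}{3s^2-2}$; - $A_{1,2,0}=-11088$, $A_{1,2,2}=15120$, $A_{1,2,3}=480$, $A_{1,2,4}=-5040$, $A_{1,2,5}=-\frac{288(13s^2-10)}{3s^2-2}$, $A_{1,2,6}=240$. *$i=2$*: - $A_{2,-2,0}=A_{2,10,0}=9$; $A_{2,-1,0}=A_{2,9,0}=108$; $A_{2,0,0}=A_{2,8,0}=594$, $A_{2,0,2}=A_{2,8,2}=-54$; - $A_{2,1,0}=A_{2,7,0}=1980$, $A_{2,1,2}=A_{2,7,2}=-540$; $A_{2,2,0}=A_{2,6,0}=4455$, $A_{2,2,2}=A_{2,6,2}=-2430$, $A_{2,2,4}=A_{2,6,4}=135$; - $A_{2,3,0}=A_{2,5,0}=7128$, $A_{2,3,2}=A_{2,5,2}=-6480$, $A_{2,3,4}=A_{2,5,4}=1080$; - $A_{2,4,0}=8316$, $A_{2,4,2}=-11340$,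 $A_{2,4,4}=3780$, $A_{2,4,6}=-180$. -/

import Mathlib

namespace Brouwer

noncomputable section

/-! ### Delaunay variables and the Poisson bracket -/

/-- A point of the phase space in Delaunay variables: the coordinates `ℓ` (mean anomaly),
`g` (argument of the perigee), `h` (longitude of the node) and their conjugate momenta
`L`, `G`, `H`. -/
@[ext]
structure Delaunay where
  /-- mean anomaly -/
  ℓ : ℝ
  /-- argument of the perigee -/
  g : ℝ
  /-- longitude of the ascending node -/
  h : ℝ
  /-- Delaunay action -/
  L : ℝ
  /-- total angular momentum -/
  G : ℝ
  /-- axial component of the angular momentum -/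
  H : ℝ

/-- The elliptic, inclined domain of the Delaunay variables: `0 < e < 1` and `0 < I < π`. -/
def Delaunay.Regular (x : Delaunay) : Prop :=
  0 < x.G ∧ x.G < x.L ∧ |x.H| < x.G

/-- `∂F/∂ℓ` -/
def dℓ (F : Delaunay → ℝ) (x : Delaunay) : ℝ := deriv (fun t => F { x with ℓ := t }) x.ℓ
/-- `∂F/∂g` -/
def dg (F : Delaunay → ℝ) (x : Delaunay) : ℝ := deriv (fun t => F { x with g := t }) x.g
/-- `∂F/∂h` -/
def dh (F : Delaunay → ℝ) (x : Delaunay) : ℝ := deriv (fun t => F { x with h := t }) x.h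
/-- `∂F/∂L` -/
def dL (F : Delaunay → ℝ) (x : Delaunay) : ℝ := deriv (fun t => F { x with L := t }) x.L
/-- `∂F/∂G` -/
def dG (F : Delaunay → ℝ) (x : Delaunay) : ℝ := deriv (fun t => F { x with G := t }) x.G
/-- `∂F/∂H` -/
def dH (F : Delaunay → ℝ) (x : Delaunay) : ℝ := deriv (fun t => F { x with H := t }) x.H

/-- All six partial derivatives of `F` exist at `x`. -/
def HasPartials (F : Delaunay → ℝ) (x : Delaunay) : Prop :=
  DifferentiableAt ℝ (fun t => F { x with ℓ := t }) x.ℓ ∧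
  DifferentiableAt ℝ (fun t => F { x with g := t }) x.g ∧
  DifferentiableAt ℝ (fun t => F { x with h := t }) x.h ∧
  DifferentiableAt ℝ (fun t => F { x with L := t }) x.L ∧
  DifferentiableAt ℝ (fun t => F { x with G := t }) x.G ∧
  DifferentiableAt ℝ (fun t => F { x with H := t }) x.H

/-- The Poisson bracket `{A, B}` in the canonical pairs `(ℓ, L)`, `(g, G)`, `(h, H)`. -/
def poisson (A B : Delaunay → ℝ) (x : Delaunay) : ℝ :=
  (dℓ A x * dL B x - dL A x * dℓ B x) +
  (dg A x * dG B x - dG A x * dg B x) +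
  (dh A x * dH B x - dH A x * dh B x)

/-- The average `⟨F⟩_ℓ` over the mean anomaly, the other Delaunay variables being fixed. -/
def average (F : Delaunay → ℝ) (x : Delaunay) : ℝ :=
  (1 / (2 * Real.pi)) * ∫ t in (0 : ℝ)..(2 * Real.pi), F { x with ℓ := t }

/-! ### Keplerian functions -/

/-- The eccentric anomaly: the solution `E` of Kepler's equation `E - e sin E = M`
(unique for `0 ≤ e < 1`, see `eccentricAnomaly_iff`). -/
def eccentricAnomaly (e M : ℝ) : ℝ :=
  Function.invFun (fun E : ℝ => E - e * Real.sin E) M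

/-- The true anomaly as a function of the eccentricity and of the mean anomaly, on its
continuous branch (the difference with the mean anomaly is periodic); see
`cos_sin_trueAnomaly` for its relation with the eccentric anomaly. -/
def trueAnomaly (e M : ℝ) : ℝ :=
  eccentricAnomaly e M +
    2 * Real.arctan
      ((e / (1 + √(1 - e ^ 2))) * Real.sin (eccentricAnomaly e M) /
        (1 - (e / (1 + √(1 - e ^ 2))) * Real.cos (eccentricAnomaly e M)))

/-- semi-major axis, from `L = √(μ a)` -/
def sma (μ : ℝ) (x : Delaunay) : ℝ := x.L ^ 2 / μ

/-- mean motion -/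
def meanMotion (μ : ℝ) (x : Delaunay) : ℝ := μ ^ 2 / x.L ^ 3

/-- eccentricity, from `G = L √(1 - e²)` -/
def ecc (x : Delaunay) : ℝ := √(1 - (x.G / x.L) ^ 2)

/-- eccentricity function `η = √(1 - e²)` -/
def eta (x : Delaunay) : ℝ := √(1 - ecc x ^ 2)

/-- orbit parameter `p = a η²` -/
def param (μ : ℝ) (x : Delaunay) : ℝ := sma μ x * eta x ^ 2

/-- inclination, from `H = G cos I` -/
def incl (x : Delaunay) : ℝ := Real.arccos (x.H / x.G)

/-- sine of the inclination -/
def sinI (x : Delaunay) : ℝ := Real.sin (incl x)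

/-- true anomaly -/
def anom (x : Delaunay) : ℝ := trueAnomaly (ecc x) x.ℓ

/-- equation of the center -/
def eqCenter (x : Delaunay) : ℝ := anom x - x.ℓ

/-- radius, from the conic equation -/
def radius (μ : ℝ) (x : Delaunay) : ℝ := param μ x / (1 + ecc x * Real.cos (anom x))

/-! ### The main problem and its complete normalization

`μ` is the gravitational parameter and `R` the equatorial radius. -/

/-- The oblateness perturbation `ℋ₁₀`: the Hamiltonian of the main problem is
`-μ / (2 a) + J₂ ℋ₁₀`. -/
def H10 (μ R : ℝ) (x : Delaunay) : ℝ :=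
  -(μ / radius μ x) * (R ^ 2 / radius μ x ^ 2) * (1 / 2) *
    (1 - 3 / 2 * sinI x ^ 2 + 3 / 2 * sinI x ^ 2 * Real.cos (2 * anom x + 2 * x.g))

/-- The first order normalized Hamiltonian `ℋ₀₁ = ⟨ℋ₁₀⟩_ℓ`. -/
def H01 (μ R : ℝ) : Delaunay → ℝ := average (H10 μ R)

/-- The inclination polynomials `B₀ = 1 - (3/2) s²`, `B₁ = (3/4) s²`. -/
def inclB (s : ℝ) : ℕ → ℝ
  | 0 => 1 - 3 / 2 * s ^ 2
  | 1 => 3 / 4 * s ^ 2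
  | _ => 0

/-- The part of the first order determining function that depends on the mean anomaly. -/
def V1 (μ R : ℝ) (x : Delaunay) : ℝ :=
  -x.G * (R ^ 2 / param μ x ^ 2) * (1 / 2) *
    (inclB (sinI x) 0 * eqCenter x +
      ∑ i ∈ Finset.range 2, inclB (sinI x) i *
        ∑ j ∈ Finset.Icc (max i 1) (2 * i + 1),
          ((2 - ((j % 2 : ℕ) : ℝ)) ^ i / (j : ℝ)) * ecc x ^ ((j : ℤ) - 2 * (i : ℤ)).natAbs *
            Real.sin ((j : ℝ) * anom x + 2 * (i : ℝ) * x.g))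

/-- The first order integration "constant". -/
def C1 (μ R : ℝ) (x : Delaunay) : ℝ :=
  x.G * (R ^ 2 / param μ x ^ 2) *
    ((15 * sinI x ^ 2 - 14) / (32 * (5 * sinI x ^ 2 - 4))) *
      sinI x ^ 2 * ecc x ^ 2 * Real.sin (2 * x.g)

/-- The first order term `𝒲₁` of the determining function. -/
def W1 (μ R : ℝ) (x : Delaunay) : ℝ := V1 μ R x + C1 μ R x

/-- The known second order terms `{ℋ₁₀; 𝒲₁} + {ℋ₀₁; 𝒲₁}`. -/
def Htilde02 (μ R : ℝ) (x : Delaunay) : ℝ :=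
  poisson (H10 μ R) (W1 μ R) x + poisson (H01 μ R) (W1 μ R) x

/-- The second order normalized Hamiltonian, the average over the mean anomaly of the known
second order terms. -/
def H02 (μ R : ℝ) : Delaunay → ℝ := average (Htilde02 μ R)

/-- A primitive, in the mean anomaly, of the right-hand side of the second order homological
equation. -/
def V2 (μ R : ℝ) (x : Delaunay) : ℝ :=
  (1 / meanMotion μ x) *
    ∫ t in (0 : ℝ)..x.ℓ, (Htilde02 μ R { x with ℓ := t } - H02 μ R { x with ℓ := t })

/-- The second order term `𝒲₂` of the determining function, with the integration
"constant" `C2`, a function that is free from the mean anomaly. -/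
def W2 (μ R : ℝ) (C2 : Delaunay → ℝ) (x : Delaunay) : ℝ := V2 μ R x + C2 x

/-- The first order periodic correction `Δξ = {ξ, 𝒲₁}`. -/
def Delta (μ R : ℝ) (ξ : Delaunay → ℝ) : Delaunay → ℝ := poisson ξ (W1 μ R)

/-- The inverse second order periodic correction `δξ = {Δξ, 𝒲₁} - {ξ, 𝒲₂}`. -/
def invDelta (μ R : ℝ) (C2 : Delaunay → ℝ) (ξ : Delaunay → ℝ) (x : Delaunay) : ℝ :=
  poisson (Delta μ R ξ) (W1 μ R) x - poisson ξ (W2 μ R C2) x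

/-! ### The inclination coefficients `A_{i,j,k}` -/

/-- `A_{0,6,0}` -/
def A060 (s : ℝ) : ℝ := 2 * (27 * s ^ 4 - 24 * s ^ 2 + 8)

/-- `A_{0,3,3}` -/
def A033 (s : ℝ) : ℝ := -16 * (3 * s ^ 2 - 2) ^ 2

/-- The coefficients of a row: the list of `A_{i,j,0}, A_{i,j,1}, …`; missing entries are null. -/
def rowA (s : ℝ) : ℕ → ℤ → List ℝ
  | 2, -2 => [9]
  | 2, -1 => [108]
  | 2, 0 => [594, 0, -54]
  | 2, 1 => [1980, 0, -540]
  | 2, 2 => [4455, 0, -2430, 0, 135]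
  | 2, 3 => [7128, 0, -6480, 0, 1080]
  | 2, 4 => [8316, 0, -11340, 0, 3780, 0, -180]
  | 2, 5 => [7128, 0, -6480, 0, 1080]
  | 2, 6 => [4455, 0, -2430, 0, 135]
  | 2, 7 => [1980, 0, -540]
  | 2, 8 => [594, 0, -54]
  | 2, 9 => [108]
  | 2, 10 => [9]
  | 1, -4 => [-12]
  | 1, -3 => [-144]
  | 1, -2 => [-792, 0, 72]
  | 1, -1 => [-2640, 0, 720, 24]
  | 1, 0 => [-5940, 0, 3240, 144, -180]
  | 1, 1 => [-9504, 0, 8640, 360, -1440, -(72 * (43 * s ^ 2 - 34)) / (3 * s ^ 2 - 2)]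
  | 1, 2 => [-11088, 0, 15120, 480, -5040, -(288 * (13 * s ^ 2 - 10)) / (3 * s ^ 2 - 2), 240]
  | 1, 3 => [-9504, 0, 8640, 360, -1440, -(24 * (49 * s ^ 2 - 38)) / (3 * s ^ 2 - 2)]
  | 1, 4 => [-5940, 0, 3240, 144, -180]
  | 1, 5 => [-2640, 0, 720, 24]
  | 1, 6 => [-792, 0, 72]
  | 1, 7 => [-144]
  | 1, 8 => [-12]
  | 0, 0 => [462 * A060 s, 0, -630 * A060 s, 10 * A033 s, 210 * A060 s,
      24 * (71 * s ^ 4 - 128 * s ^ 2 + 56), -4 * (63 * s ^ 4 - 24 * s ^ 2 + 8)]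
  | 0, 1 => [792 * A060 s, 0, -720 * A060 s, 15 * A033 s, 120 * A060 s, -3 * A033 s]
  | 0, 2 => [495 * A060 s, 0, -270 * A060 s, 6 * A033 s, 15 * A060 s]
  | 0, 3 => [220 * A060 s, 0, -60 * A060 s, A033 s]
  | 0, 4 => [66 * A060 s, 0, -6 * A060 s]
  | 0, 5 => [12 * A060 s]
  | 0, 6 => [A060 s]
  | _, _ => []

/-- The inclination coefficient `A_{i,j,k}(s)`. -/
def coeffA (s : ℝ) (i : ℕ) (j : ℤ) (k : ℕ) : ℝ := (rowA s i j).getD k 0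

/-- The product `(3 s² - 2)^{i mod 2} A_{i,j,k}(s)` as a polynomial in `s`, the divisor of
`A_{1,1,5}`, `A_{1,2,5}`, `A_{1,3,5}` being cancelled (so that the value at `3 s² = 2` is
the right one); see `inclCoeff_eq`. -/
def inclCoeff (s : ℝ) (i : ℕ) (j : ℤ) (k : ℕ) : ℝ :=
  if i = 1 ∧ j = 1 ∧ k = 5 then -(72 * (43 * s ^ 2 - 34))
  else if i = 1 ∧ j = 2 ∧ k = 5 then -(288 * (13 * s ^ 2 - 10))
  else if i = 1 ∧ j = 3 ∧ k = 5 then -(24 * (49 * s ^ 2 - 38))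
  else (3 * s ^ 2 - 2) ^ (i % 2) * coeffA s i j k

/-- The trigonometric series of the inverse second order correction to the semi-major axis. -/
def smaSeries (x : Delaunay) : ℝ :=
  ∑ i ∈ Finset.range 3,
    ∑ j ∈ Finset.Icc (-(i : ℤ) - 3 * ((i % 2 : ℕ) : ℤ)) (6 + 2 * (i : ℤ)),
      ∑ k ∈ Finset.range (6 - (j - 2 * (i : ℤ)).natAbs + 1),
        sinI x ^ (2 * i) * inclCoeff (sinI x) i j k * eta x ^ k *
          ecc x ^ (j - 2 * (i : ℤ)).natAbs *
            Real.cos ((j : ℝ) * anom x + 2 * (i : ℝ) * x.g)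

/-! ### Checks on the definitions -/

theorem inclCoeff_eq (s : ℝ) (hs : 3 * s ^ 2 ≠ 2) (i : ℕ) (j : ℤ) (k : ℕ) :
    inclCoeff s i j k = (3 * s ^ 2 - 2) ^ (i % 2) * coeffA s i j k := by
  have h : 3 * s ^ 2 - 2 ≠ 0 := sub_ne_zero.2 hs
  unfold inclCoeff
  split_ifs with h1 h2 h3
  · obtain ⟨rfl, rfl, rfl⟩ := h1
    simp only [coeffA, rowA, List.getD_cons_succ, List.getD_cons_zero, Nat.one_mod, pow_one]
    rw [mul_div_cancel₀ _ h]
  · obtain ⟨rfl, rfl, rfl⟩ := h2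
    simp only [coeffA, rowA, List.getD_cons_succ, List.getD_cons_zero, Nat.one_mod, pow_one]
    rw [mul_div_cancel₀ _ h]
  · obtain ⟨rfl, rfl, rfl⟩ := h3
    simp only [coeffA, rowA, List.getD_cons_succ, List.getD_cons_zero, Nat.one_mod, pow_one]
    rw [mul_div_cancel₀ _ h]
  · rfl

theorem kepler_strictMono {e : ℝ} (h0 : 0 ≤ e) (h1 : e < 1) :
    StrictMono (fun E : ℝ => E - e * Real.sin E) := by
  refine strictMono_of_deriv_pos fun E => ?_
  have hd : HasDerivAt (fun E : ℝ => E - e * Real.sin E) (1 - e * Real.cos E) E :=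
    (hasDerivAt_id E).sub ((Real.hasDerivAt_sin E).const_mul e)
  rw [hd.deriv]
  nlinarith [Real.cos_le_one E]

theorem eccentricAnomaly_iff {e : ℝ} (h0 : 0 ≤ e) (h1 : e < 1) (M E : ℝ) :
    eccentricAnomaly e M = E ↔ E - e * Real.sin E = M := by
  have hm := kepler_strictMono h0 h1
  have hs : Function.Surjective (fun E : ℝ => E - e * Real.sin E) := by
    intro y
    have hc : Continuous (fun E : ℝ => E - e * Real.sin E) := by fun_prop
    have h := intermediate_value_Icc (a := y - 1) (b := y + 1) (by linarith) hc.continuousOn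
    have hy : y ∈ Set.Icc (y - 1 - e * Real.sin (y - 1)) (y + 1 - e * Real.sin (y + 1)) := by
      constructor
      · nlinarith [Real.neg_one_le_sin (y - 1)]
      · nlinarith [Real.sin_le_one (y + 1)]
    obtain ⟨E, -, hE⟩ := h hy
    exact ⟨E, hE⟩
  have hsol := Function.rightInverse_invFun hs M
  constructor
  · rintro rfl
    exact hsol
  · intro h
    exact hm.injective (hsol.trans h.symm)

/-- The half-angle parameter `β = e / (1 + √(1 - e²))` of the true anomaly. -/
theorem beta_spec {e : ℝ} (h0 : 0 ≤ e) (h1 : e < 1) :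
    0 ≤ e / (1 + √(1 - e ^ 2)) ∧ e / (1 + √(1 - e ^ 2)) < 1 ∧
      e * (1 + (e / (1 + √(1 - e ^ 2))) ^ 2) = 2 * (e / (1 + √(1 - e ^ 2))) ∧
      √(1 - e ^ 2) * (1 + (e / (1 + √(1 - e ^ 2))) ^ 2) = 1 - (e / (1 + √(1 - e ^ 2))) ^ 2 := by
  have hq : √(1 - e ^ 2) ^ 2 = 1 - e ^ 2 := Real.sq_sqrt (by nlinarith)
  have hn : 0 ≤ √(1 - e ^ 2) := Real.sqrt_nonneg _
  generalize √(1 - e ^ 2) = q at hq hn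
  have hp : 0 < 1 + q := by linarith
  refine ⟨by positivity, ?_, ?_, ?_⟩
  · rw [div_lt_one hp]
    linarith
  · field_simp
    linear_combination e * hq
  · field_simp
    linear_combination (1 + q) * hq

theorem cos_sin_trueAnomaly {e : ℝ} (h0 : 0 ≤ e) (h1 : e < 1) (M : ℝ) :
    Real.cos (trueAnomaly e M) * (1 - e * Real.cos (eccentricAnomaly e M)) =
        Real.cos (eccentricAnomaly e M) - e ∧
      Real.sin (trueAnomaly e M) * (1 - e * Real.cos (eccentricAnomaly e M)) =
        √(1 - e ^ 2) * Real.sin (eccentricAnomaly e M) := by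
  obtain ⟨b0, b1, he, hq⟩ := beta_spec h0 h1
  unfold trueAnomaly
  generalize e / (1 + √(1 - e ^ 2)) = b at *
  generalize √(1 - e ^ 2) = q at *
  generalize eccentricAnomaly e M = E
  have hcs := Real.sin_sq_add_cos_sq E
  have hc : 0 < 1 - b * Real.cos E := by nlinarith [Real.cos_le_one E]
  have hC := Real.cos_sq_arctan (b * Real.sin E / (1 - b * Real.cos E))
  have hS : Real.sin (Real.arctan (b * Real.sin E / (1 - b * Real.cos E))) =
      b * Real.sin E / (1 - b * Real.cos E) *
        Real.cos (Real.arctan (b * Real.sin E / (1 - b * Real.cos E))) := by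
    rw [Real.sin_arctan, Real.cos_arctan]
    ring
  rw [Real.cos_add, Real.sin_add, Real.sin_two_mul, Real.cos_two_mul, hS]
  generalize Real.cos (Real.arctan (b * Real.sin E / (1 - b * Real.cos E))) = w at *
  generalize Real.cos E = c at *
  generalize Real.sin E = s at *
  have he' : e = 2 * b / (1 + b ^ 2) := by
    rw [eq_div_iff (by positivity)]
    exact he
  have hq' : q = (1 - b ^ 2) / (1 + b ^ 2) := by
    rw [eq_div_iff (by positivity)]
    exact hq
  have hN : (1 - b * c) ^ 2 + (b * s) ^ 2 = 1 + b ^ 2 - 2 * b * c := by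
    linear_combination b ^ 2 * hcs
  have hD : 0 < 1 + b ^ 2 - 2 * b * c := by
    rw [← hN]
    positivity
  have hw : w ^ 2 = (1 - b * c) ^ 2 / (1 + b ^ 2 - 2 * b * c) := by
    rw [hC, ← hN]
    field_simp
  have e1 : 2 * (b * s / (1 - b * c) * w) * w = 2 * (b * s / (1 - b * c)) * w ^ 2 := by ring
  have e2 : 2 * (b * s / (1 - b * c)) * ((1 - b * c) ^ 2 / (1 + b ^ 2 - 2 * b * c)) =
      2 * b * s * (1 - b * c) / (1 + b ^ 2 - 2 * b * c) := by
    field_simp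
  have e3 : 1 - 2 * b / (1 + b ^ 2) * c = (1 + b ^ 2 - 2 * b * c) / (1 + b ^ 2) := by
    field_simp
  have e4 : 2 * ((1 - b * c) ^ 2 / (1 + b ^ 2 - 2 * b * c)) - 1 =
      (2 * (1 - b * c) ^ 2 - (1 + b ^ 2 - 2 * b * c)) / (1 + b ^ 2 - 2 * b * c) := by
    field_simp
  have hb : (0 : ℝ) < 1 + b ^ 2 := by positivity
  have hDne := hD.ne'
  have hbne := hb.ne'
  rw [e1, hw, he', hq', e2, e3, e4]
  generalize hNN : 1 + b ^ 2 - 2 * b * c = N at *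
  constructor
  · field_simp
    subst hNN
    linear_combination (-2 * b * (1 - b * c)) * hcs
  · field_simp
    subst hNN
    ring

end

end Brouwer

namespace Brouwer

open Real Filter Topology

noncomputable section

/-! The semi-major axis depends on L alone, so {a, B} = -(2L/μ) ∂B/∂ℓ (`poisson_sma`), and the
homological equations make both brackets with a explicit: Δa = -(2L⁴/μ³)(ℋ₁₀ - ℋ₀₁) and {a, 𝒲₂} =
-(2L⁴/μ³)(ℋ̃₀₂ - ℋ₀₂). In δa the bracket {ℋ₁₀, 𝒲₁} cancels. What remains is (ℋ₁₀ - ℋ₀₁)²/n, the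
bracket {ℋ₀₁, 𝒲₁}, which needs only ∂𝒲₁/∂ℓ and ∂𝒲₁/∂g because ℋ₀₁ is free from the angles, and ℋ₀₂
(`invDelta_sma`). The equation of the center has then disappeared, and the only hard ingredient is
the average ℋ₀₂ (`H02_eq`).

That average is found by integrating by parts in ℓ. Since n ∂𝒲₁/∂ℓ = ℋ₁₀ - ℋ₀₁, the function ℋ̃₀₂ is
the ℓ-derivative of a periodic function plus a remainder in which the mean anomaly occurs only
through f (`hasDerivAt_oscPrimitive`). The substitution dℓ = η³ df/(1 + e cos f)² then turns
averages into integrals of trigonometric polynomials (`IsAnomaly.integral_eq`). Factors that are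
derivatives in e at constant ℓ are first removed by an exact derivative
(`IsAnomaly.integral_leibniz`), which replaces differentiation under the integral sign.

Finally the series is compared with the closed form (`smaSeries_closed`): centering each harmonic on
i(2f + 2g) gives a polynomial identity in e, η, sin I, cos f, sin f and the cosine and sine of 2f +
2g, modulo η² = 1 - e². The coefficient q of the integration constant enters through ∂𝒲₁/∂g and
through ℋ₀₂ with opposite signs and drops out.

All partial derivatives come from one chain rule: `HasGradient` differentiates along arbitrary
curves, starting from the derivatives of the Keplerian anomalies, which the inverse function theorem
provides. -/

/-! ### Differentiation of the eccentric and true anomalies -/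

theorem kepler_eccentricAnomaly {e : ℝ} (h0 : 0 ≤ e) (h1 : e < 1) (M : ℝ) :
    eccentricAnomaly e M - e * sin (eccentricAnomaly e M) = M :=
  (eccentricAnomaly_iff h0 h1 M _).1 rfl

theorem one_sub_mul_cos_pos {e : ℝ} (h0 : 0 ≤ e) (h1 : e < 1) (E : ℝ) : 0 < 1 - e * cos E := by
  nlinarith [cos_le_one E]

/-- The differential of `(e, E) ↦ (e, E - e sin E)` as an equivalence, with `a = sin E` and
`b = 1 - e cos E`. -/
def keplerEquiv (a b : ℝ) (hb : b ≠ 0) : (ℝ × ℝ) ≃L[ℝ] (ℝ × ℝ) :=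
  ContinuousLinearEquiv.equivOfInverse
    ((ContinuousLinearMap.fst ℝ ℝ ℝ).prod
      (b • ContinuousLinearMap.snd ℝ ℝ ℝ - a • ContinuousLinearMap.fst ℝ ℝ ℝ))
    ((ContinuousLinearMap.fst ℝ ℝ ℝ).prod
      (b⁻¹ • (ContinuousLinearMap.snd ℝ ℝ ℝ + a • ContinuousLinearMap.fst ℝ ℝ ℝ)))
    (by
      rintro ⟨p, q⟩
      ext <;> simp
      field_simp
      ring)
    (by
      rintro ⟨p, q⟩
      ext <;> simp
      field_simp
      ring)

theorem keplerEquiv_symm_apply (a b : ℝ) (hb : b ≠ 0) (z : ℝ × ℝ) :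
    (keplerEquiv a b hb).symm z = (z.1, b⁻¹ * (z.2 + a * z.1)) := rfl

/-- The derivative of the eccentric anomaly along a curve. -/
theorem hasDerivAt_eccentricAnomaly {e M : ℝ → ℝ} {e' M' t : ℝ} (he : HasDerivAt e e' t)
    (hM : HasDerivAt M M' t) (h0 : 0 < e t) (h1 : e t < 1) :
    HasDerivAt (fun τ => eccentricAnomaly (e τ) (M τ))
      ((M' + sin (eccentricAnomaly (e t) (M t)) * e') /
        (1 - e t * cos (eccentricAnomaly (e t) (M t)))) t := by
  set E := eccentricAnomaly (e t) (M t) with hE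
  have hb : 1 - e t * cos E ≠ 0 := (one_sub_mul_cos_pos h0.le h1 E).ne'
  have hΦ : HasStrictFDerivAt (fun z : ℝ × ℝ => (z.1, z.2 - z.1 * sin z.2))
      (keplerEquiv (sin E) (1 - e t * cos E) hb : ℝ × ℝ →L[ℝ] ℝ × ℝ) (e t, E) := by
    have h1 : HasStrictFDerivAt (fun z : ℝ × ℝ => z.1) (ContinuousLinearMap.fst ℝ ℝ ℝ) (e t, E) :=
      hasStrictFDerivAt_fst
    have h2 : HasStrictFDerivAt (fun z : ℝ × ℝ => z.2) (ContinuousLinearMap.snd ℝ ℝ ℝ) (e t, E) :=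
      hasStrictFDerivAt_snd
    have h3 := h1.prodMk (h2.sub (h1.mul
      ((hasStrictDerivAt_sin E).comp_hasStrictFDerivAt (e t, E) h2)))
    refine h3.congr_fderiv ?_
    ext <;> simp [keplerEquiv]
  have hinv : ∀ᶠ z in nhds (e t, E), (fun w : ℝ × ℝ => (w.1, eccentricAnomaly w.1 w.2))
      ((fun z : ℝ × ℝ => (z.1, z.2 - z.1 * sin z.2)) z) = z := by
    have ho : ∀ᶠ z in nhds (e t, E), z.1 ∈ Set.Ioo (0 : ℝ) 1 :=
      continuous_fst.continuousAt.eventually_mem (Ioo_mem_nhds h0 h1)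
    filter_upwards [ho] with z hz
    exact Prod.ext rfl ((eccentricAnomaly_iff hz.1.le hz.2 _ _).2 rfl)
  -- Solving Kepler's equation gives a left inverse of (e, E) ↦ (e, E - e sin E) wherever 0 < e < 1.
  -- Strict differentiability with invertible differential then yields the derivative of the
  -- inverse, whose continuity need not be known beforehand.
  have hg := hΦ.to_local_left_inverse
    (g := fun w : ℝ × ℝ => (w.1, eccentricAnomaly w.1 w.2)) hinv
  dsimp only at hg
  rw [show E - e t * sin E = M t from kepler_eccentricAnomaly h0.le h1 (M t)] at hg
  have hcurve := hg.hasFDerivAt.comp_hasDerivAt t (he.prodMk hM)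
  refine (hcurve.hasFDerivAt.snd.hasDerivAt).congr_deriv ?_
  simp [keplerEquiv_symm_apply, div_eq_inv_mul]

/-- The derivative of `E + 2 arctan (β sin E / (1 - β cos E))` along a curve. -/
theorem hasDerivAt_add_two_arctan {b E : ℝ → ℝ} {b' E' t : ℝ} (hb : HasDerivAt b b' t)
    (hE : HasDerivAt E E' t) (h0 : 0 ≤ b t) (h1 : b t < 1) :
    HasDerivAt (fun τ => E τ + 2 * arctan (b τ * sin (E τ) / (1 - b τ * cos (E τ))))
      (((1 - b t ^ 2) * E' + 2 * sin (E t) * b') / (1 + b t ^ 2 - 2 * b t * cos (E t))) t := by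
  have hc := one_sub_mul_cos_pos h0 h1 (E t)
  have hcs := sin_sq_add_cos_sq (E t)
  have hD : (1 - b t * cos (E t)) ^ 2 + (b t * sin (E t)) ^ 2 =
      1 + b t ^ 2 - 2 * b t * cos (E t) := by linear_combination b t ^ 2 * hcs
  have hN : 0 < 1 + b t ^ 2 - 2 * b t * cos (E t) := by
    rw [← hD]
    positivity
  refine (hE.add ((((hb.mul hE.sin).div ((hb.mul hE.cos).const_sub 1) hc.ne').arctan).const_mul
    2)).congr_deriv ?_
  have e1 : 1 + (b t * sin (E t) / (1 - b t * cos (E t))) ^ 2 =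
      (1 + b t ^ 2 - 2 * b t * cos (E t)) / (1 - b t * cos (E t)) ^ 2 := by
    rw [← hD]
    field_simp
  simp only [Pi.mul_apply, Pi.div_apply]
  rw [e1]
  have hc' := hc.ne'
  have hN' := hN.ne'
  generalize hX : 1 - b t * cos (E t) = X at *
  generalize hY : 1 + b t ^ 2 - 2 * b t * cos (E t) = N at *
  field_simp
  subst hX hY
  generalize sin (E t) = S at *
  generalize cos (E t) = c at *
  linear_combination (-2 * b t ^ 2 * E') * hcs

/-- The derivative of the true anomaly along a curve. -/
theorem hasDerivAt_trueAnomaly {e M : ℝ → ℝ} {e' M' t : ℝ} (he : HasDerivAt e e' t)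
    (hM : HasDerivAt M M' t) (h0 : 0 < e t) (h1 : e t < 1) :
    HasDerivAt (fun τ => trueAnomaly (e τ) (M τ))
      (sin (trueAnomaly (e t) (M t)) * (2 + e t * cos (trueAnomaly (e t) (M t))) /
          (1 - e t ^ 2) * e' +
        (1 + e t * cos (trueAnomaly (e t) (M t))) ^ 2 / √(1 - e t ^ 2) ^ 3 * M') t := by
  have hEd := hasDerivAt_eccentricAnomaly he hM h0 h1
  obtain ⟨hc, hs⟩ := cos_sin_trueAnomaly h0.le h1 (M t)
  obtain ⟨b0, b1, hbe, hbq⟩ := beta_spec h0.le h1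
  have hpos : 0 < 1 - e t ^ 2 := by nlinarith
  have hq : √(1 - e t ^ 2) ^ 2 = 1 - e t ^ 2 := sq_sqrt hpos.le
  have hqp : 0 < √(1 - e t ^ 2) := sqrt_pos.2 hpos
  have hqd : HasDerivAt (fun τ => √(1 - e τ ^ 2)) (-(e t * e') / √(1 - e t ^ 2)) t := by
    refine (((he.pow 2).const_sub 1).sqrt hpos.ne').congr_deriv ?_
    simp only [Pi.pow_apply]
    field_simp
    norm_num
    ring
  have hbd : HasDerivAt (fun τ => e τ / (1 + √(1 - e τ ^ 2)))
      (e' / (√(1 - e t ^ 2) * (1 + √(1 - e t ^ 2)))) t := by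
    refine (he.div (hqd.const_add 1) (by positivity)).congr_deriv ?_
    field_simp
    linear_combination e' * hq
  have hT := hasDerivAt_add_two_arctan hbd hEd b0 b1
  refine hT.congr_deriv ?_
  have hr := one_sub_mul_cos_pos h0.le h1 (eccentricAnomaly (e t) (M t))
  have hcs := sin_sq_add_cos_sq (eccentricAnomaly (e t) (M t))
  generalize eccentricAnomaly (e t) (M t) = E at *
  have hc' : cos (trueAnomaly (e t) (M t)) = (cos E - e t) / (1 - e t * cos E) := by
    rw [eq_div_iff hr.ne', hc]
  have hs' : sin (trueAnomaly (e t) (M t)) =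
      √(1 - e t ^ 2) * sin E / (1 - e t * cos E) := by
    rw [eq_div_iff hr.ne', hs]
  rw [hc', hs']
  generalize √(1 - e t ^ 2) = q at *
  generalize e t = e at *
  generalize sin E = S at *
  generalize cos E = c at *
  -- Here q = η. The four identities put every factor over 1 - e cos E or 1 + q, so that the
  -- derivative found in terms of E can be compared with its expression in terms of f.
  have h2 : 1 + e * ((c - e) / (1 - e * c)) = q ^ 2 / (1 - e * c) := by
    field_simp
    linear_combination -hq
  have h3 : 2 + e * ((c - e) / (1 - e * c)) = (1 - e * c + q ^ 2) / (1 - e * c) := by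
    field_simp
    linear_combination -hq
  have hD : 1 + (e / (1 + q)) ^ 2 - 2 * (e / (1 + q)) * c = 2 * (1 - e * c) / (1 + q) := by
    field_simp
    linear_combination hq
  have hB : 1 - (e / (1 + q)) ^ 2 = 2 * q / (1 + q) := by
    field_simp
    linear_combination -hq
  rw [h2, h3, hD, hB, ← hq]
  have hr' := hr.ne'
  generalize 1 - e * c = r at *
  field_simp
  ring

theorem trueAnomaly_zero {e : ℝ} (h0 : 0 ≤ e) (h1 : e < 1) : trueAnomaly e 0 = 0 := by
  have h : eccentricAnomaly e 0 = 0 := (eccentricAnomaly_iff h0 h1 _ _).2 (by simp)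
  simp [trueAnomaly, h]

/-- The arctangent correction vanishes with sin E, so f and ℓ agree at both ends of the period. This
fixes the branch and gives the limits of integration when ℓ is exchanged for f. -/
theorem trueAnomaly_two_pi {e : ℝ} (h0 : 0 ≤ e) (h1 : e < 1) :
    trueAnomaly e (2 * π) = 2 * π := by
  have h : eccentricAnomaly e (2 * π) = 2 * π := (eccentricAnomaly_iff h0 h1 _ _).2 (by simp)
  simp [trueAnomaly, h]

/-! ### The Keplerian functions on the regular domain -/

theorem Delaunay.Regular.L_pos {x : Delaunay} (hx : x.Regular) : 0 < x.L := hx.1.trans hx.2.1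

theorem Delaunay.Regular.div_sq_lt_one {x : Delaunay} (hx : x.Regular) : (x.G / x.L) ^ 2 < 1 := by
  have h0 := hx.L_pos
  have h1 : x.G / x.L < 1 := (div_lt_one h0).2 hx.2.1
  have h2 : 0 < x.G / x.L := div_pos hx.1 h0
  nlinarith

theorem ecc_sq {x : Delaunay} (hx : x.Regular) : ecc x ^ 2 = 1 - (x.G / x.L) ^ 2 :=
  sq_sqrt (by linarith [hx.div_sq_lt_one])

theorem ecc_pos {x : Delaunay} (hx : x.Regular) : 0 < ecc x :=
  sqrt_pos.2 (by linarith [hx.div_sq_lt_one])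

theorem eta_eq {x : Delaunay} (hx : x.Regular) : eta x = x.G / x.L := by
  rw [eta, ecc_sq hx, sub_sub_cancel]
  exact sqrt_sq (div_pos hx.1 hx.L_pos).le

theorem eta_pos {x : Delaunay} (hx : x.Regular) : 0 < eta x := by
  rw [eta_eq hx]
  exact div_pos hx.1 hx.L_pos

theorem eta_sq {x : Delaunay} (hx : x.Regular) : eta x ^ 2 = 1 - ecc x ^ 2 := by
  rw [ecc_sq hx, eta_eq hx]
  ring

theorem ecc_lt_one {x : Delaunay} (hx : x.Regular) : ecc x < 1 := by
  nlinarith [eta_sq hx, eta_pos hx, ecc_pos hx]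

theorem param_eq {μ : ℝ} (hμ : 0 < μ) {x : Delaunay} (hx : x.Regular) :
    param μ x = x.G ^ 2 / μ := by
  have h0 := hx.L_pos
  rw [param, sma, eta_eq hx]
  field_simp

theorem sinI_sq {x : Delaunay} (hx : x.Regular) : sinI x ^ 2 = 1 - (x.H / x.G) ^ 2 := by
  have h := abs_lt.1 hx.2.2
  have h1 : x.H / x.G ≤ 1 := (div_le_one hx.1).2 h.2.le
  have h2 : -1 ≤ x.H / x.G := (le_div_iff₀ hx.1).2 (by linarith)
  rw [sinI, incl, sin_sq, cos_arccos h2 h1]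

/-! ### Kernels of the perturbation and of the determining function

The arguments are the true anomaly `f`, the mean anomaly `ℓ`, the eccentricity `e` and
`η = √(1 - e²)`, the argument of the perigee `g`, `s = sin² I` and the coefficient `q` of the
integration constant. -/

/-- `∂f/∂ℓ` -/
def anomRate (f e η : ℝ) : ℝ := (1 + e * cos f) ^ 2 / η ^ 3

/-- `∂f/∂e` at constant mean anomaly -/
def anomEcc (f e η : ℝ) : ℝ := sin f * (2 + e * cos f) / η ^ 2

/-- The perturbation up to a factor depending on `G`. -/
def pot (f e g s : ℝ) : ℝ :=
  (1 + e * cos f) ^ 3 * (1 - 3 / 2 * s + 3 / 2 * s * cos (2 * f + 2 * g))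

def potF (f e g s : ℝ) : ℝ :=
  -3 * e * sin f * (1 + e * cos f) ^ 2 * (1 - 3 / 2 * s + 3 / 2 * s * cos (2 * f + 2 * g)) -
    3 * s * (1 + e * cos f) ^ 3 * sin (2 * f + 2 * g)

def potE (f e g s : ℝ) : ℝ :=
  3 * cos f * (1 + e * cos f) ^ 2 * (1 - 3 / 2 * s + 3 / 2 * s * cos (2 * f + 2 * g))

def potG (f e g s : ℝ) : ℝ := -3 * s * (1 + e * cos f) ^ 3 * sin (2 * f + 2 * g)

def potS (f e g : ℝ) : ℝ := (1 + e * cos f) ^ 3 * (-3 / 2 + 3 / 2 * cos (2 * f + 2 * g))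

/-- The derivative of `pot` with respect to `e` at constant mean anomaly. -/
def potEcc (f e η g s : ℝ) : ℝ := potF f e g s * anomEcc f e η + potE f e g s

/-- The determining function up to a factor depending on `G`. -/
def gen (f ℓ e g s q : ℝ) : ℝ :=
  (1 - 3 / 2 * s) * (f - ℓ + e * sin f) +
    s * (3 / 4 * sin (2 * f + 2 * g) +
      e * (sin (2 * f + 2 * g) * cos f - cos (2 * f + 2 * g) * sin f / 2)) -
    q * e ^ 2 * sin (2 * g)

def genF (f e g s : ℝ) : ℝ :=
  (1 + e * cos f) * (1 - 3 / 2 * s + 3 / 2 * s * cos (2 * f + 2 * g))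

def genE (f e g s q : ℝ) : ℝ :=
  (1 - 3 / 2 * s) * sin f +
    s * (sin (2 * f + 2 * g) * cos f - cos (2 * f + 2 * g) * sin f / 2) -
    2 * q * e * sin (2 * g)

def genG (f e g s q : ℝ) : ℝ :=
  s * (3 / 2 * cos (2 * f + 2 * g) +
    e * (2 * cos (2 * f + 2 * g) * cos f + sin (2 * f + 2 * g) * sin f)) -
    2 * q * e ^ 2 * cos (2 * g)

def genS (f ℓ e g : ℝ) : ℝ :=
  -3 / 2 * (f - ℓ + e * sin f) +
    (3 / 4 * sin (2 * f + 2 * g) +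
      e * (sin (2 * f + 2 * g) * cos f - cos (2 * f + 2 * g) * sin f / 2))

/-- The derivative of `gen` with respect to `e` at constant mean anomaly. -/
def genEcc (f e η g s q : ℝ) : ℝ := genF f e g s * anomEcc f e η + genE f e g s q

/-! ### Continuity of the kernels in the mean anomaly, for integrability -/

section Continuity

variable {f : ℝ → ℝ} {e η g s q : ℝ}

@[fun_prop]
theorem continuous_anomRate (hf : Continuous f) : Continuous fun t => anomRate (f t) e η := by
  unfold anomRate
  fun_prop

@[fun_prop]
theorem continuous_anomEcc (hf : Continuous f) : Continuous fun t => anomEcc (f t) e η := by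
  unfold anomEcc
  fun_prop

@[fun_prop]
theorem continuous_pot (hf : Continuous f) : Continuous fun t => pot (f t) e g s := by
  unfold pot
  fun_prop

@[fun_prop]
theorem continuous_potF (hf : Continuous f) : Continuous fun t => potF (f t) e g s := by
  unfold potF
  fun_prop

@[fun_prop]
theorem continuous_potE (hf : Continuous f) : Continuous fun t => potE (f t) e g s := by
  unfold potE
  fun_prop

@[fun_prop]
theorem continuous_potG (hf : Continuous f) : Continuous fun t => potG (f t) e g s := by
  unfold potG
  fun_prop

@[fun_prop]
theorem continuous_potS (hf : Continuous f) : Continuous fun t => potS (f t) e g := by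
  unfold potS
  fun_prop

@[fun_prop]
theorem continuous_potEcc (hf : Continuous f) : Continuous fun t => potEcc (f t) e η g s := by
  unfold potEcc
  fun_prop

@[fun_prop]
theorem continuous_gen (hf : Continuous f) : Continuous fun t => gen (f t) t e g s q := by
  unfold gen
  fun_prop

@[fun_prop]
theorem continuous_genF (hf : Continuous f) : Continuous fun t => genF (f t) e g s := by
  unfold genF
  fun_prop

@[fun_prop]
theorem continuous_genE (hf : Continuous f) : Continuous fun t => genE (f t) e g s q := by
  unfold genE
  fun_prop

@[fun_prop]
theorem continuous_genG (hf : Continuous f) : Continuous fun t => genG (f t) e g s q := by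
  unfold genG
  fun_prop

@[fun_prop]
theorem continuous_genS (hf : Continuous f) : Continuous fun t => genS (f t) t e g := by
  unfold genS
  fun_prop

@[fun_prop]
theorem continuous_genEcc (hf : Continuous f) : Continuous fun t => genEcc (f t) e η g s q := by
  unfold genEcc
  fun_prop

end Continuity

/-! ### Chain rules for the kernels, and reduction of the Hamiltonian and determining function to
them -/

section Curves

variable {f ℓ e g s q : ℝ → ℝ} {f' ℓ' e' g' s' q' t : ℝ}

theorem hasDerivAt_pot (hf : HasDerivAt f f' t) (he : HasDerivAt e e' t) (hg : HasDerivAt g g' t)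
    (hs : HasDerivAt s s' t) :
    HasDerivAt (fun τ => pot (f τ) (e τ) (g τ) (s τ))
      (potF (f t) (e t) (g t) (s t) * f' + potE (f t) (e t) (g t) (s t) * e' +
        potG (f t) (e t) (g t) (s t) * g' + potS (f t) (e t) (g t) * s') t := by
  have h2 : HasDerivAt (fun τ => 2 * f τ + 2 * g τ) (2 * f' + 2 * g') t :=
    (hf.const_mul 2).add (hg.const_mul 2)
  have h := (((he.mul hf.cos).const_add 1).pow 3).mul
    (((hs.const_mul (3 / 2)).const_sub 1).add ((hs.const_mul (3 / 2)).mul h2.cos))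
  refine h.congr_deriv ?_
  simp only [potF, potE, potG, potS, Pi.mul_apply, Pi.add_apply, Pi.pow_apply]
  push_cast
  ring

theorem hasDerivAt_gen (hf : HasDerivAt f f' t) (hℓ : HasDerivAt ℓ ℓ' t) (he : HasDerivAt e e' t)
    (hg : HasDerivAt g g' t) (hs : HasDerivAt s s' t) (hq : HasDerivAt q q' t) :
    HasDerivAt (fun τ => gen (f τ) (ℓ τ) (e τ) (g τ) (s τ) (q τ))
      (genF (f t) (e t) (g t) (s t) * f' - (1 - 3 / 2 * s t) * ℓ' +
        genE (f t) (e t) (g t) (s t) (q t) * e' + genG (f t) (e t) (g t) (s t) (q t) * g' +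
        genS (f t) (ℓ t) (e t) (g t) * s' - e t ^ 2 * sin (2 * g t) * q') t := by
  have h2 : HasDerivAt (fun τ => 2 * f τ + 2 * g τ) (2 * f' + 2 * g') t :=
    (hf.const_mul 2).add (hg.const_mul 2)
  have h := ((((hs.const_mul (3 / 2)).const_sub 1).mul ((hf.sub hℓ).add (he.mul hf.sin))).add
    (hs.mul ((h2.sin.const_mul (3 / 4)).add
      (he.mul ((h2.sin.mul hf.cos).sub ((h2.cos.mul hf.sin).div_const 2)))))).sub
    ((hq.mul (he.pow 2)).mul (hg.const_mul 2).sin)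
  refine h.congr_deriv ?_
  simp only [genF, genE, genG, genS, Pi.mul_apply, Pi.add_apply, Pi.sub_apply, Pi.pow_apply]
  push_cast
  ring

end Curves

/-- The coefficient of the integration constant. -/
def constCoeff (s : ℝ) : ℝ := (15 * s - 14) / (16 * (5 * s - 4)) * s

theorem differentiableAt_constCoeff {s : ℝ} (hs : 5 * s ≠ 4) : DifferentiableAt ℝ constCoeff s := by
  have h : 16 * (5 * s - 4) ≠ 0 := mul_ne_zero (by norm_num) (sub_ne_zero.2 hs)
  unfold constCoeff
  fun_prop (disch := exact h)

/-- Because p = G²/μ, the prefactor depends on G only; L enters through e and f alone. The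
inclination enters through its squared sine, which is rational in H/G. -/
theorem H10_eq {μ : ℝ} (hμ : 0 < μ) (R : ℝ) {x : Delaunay} (hx : x.Regular) :
    H10 μ R x = -(μ ^ 4 * R ^ 2 / (2 * x.G ^ 6)) * pot (anom x) (ecc x) x.g (sinI x ^ 2) := by
  have hG := hx.1.ne'
  rw [H10, radius, param_eq hμ hx, pot]
  field_simp

theorem W1_eq {μ : ℝ} (hμ : 0 < μ) (R : ℝ) {x : Delaunay} (hx : x.Regular)
    (hc : 5 * sinI x ^ 2 ≠ 4) :
    W1 μ R x = -(μ ^ 2 * R ^ 2 / (2 * x.G ^ 3)) *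
      gen (anom x) x.ℓ (ecc x) x.g (sinI x ^ 2) (constCoeff (sinI x ^ 2)) := by
  have hG := hx.1.ne'
  have hc' : 5 * sinI x ^ 2 - 4 ≠ 0 := sub_ne_zero.2 hc
  have h1 : sin (anom x + 2 * x.g) = sin (2 * anom x + 2 * x.g) * cos (anom x) -
      cos (2 * anom x + 2 * x.g) * sin (anom x) := by
    rw [← sin_sub]
    ring_nf
  have h3 : sin (3 * anom x + 2 * x.g) = sin (2 * anom x + 2 * x.g) * cos (anom x) +
      cos (2 * anom x + 2 * x.g) * sin (anom x) := by
    rw [← sin_add]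
    ring_nf
  -- The row i = 0 has the single term e sin f. The row i = 1 has e sin(f + 2g), sin(2f + 2g) and
  -- (e/3) sin(3f + 2g), which `h1` and `h3` regroup around the angle 2f + 2g.
  have hI0 : Finset.Icc (max 0 1) (2 * 0 + 1) = {1} := rfl
  have hI1 : Finset.Icc (max 1 1) (2 * 1 + 1) = {1, 2, 3} := rfl
  rw [W1, V1, C1, param_eq hμ hx, gen, constCoeff, eqCenter, Finset.sum_range_succ,
    Finset.sum_range_one, hI0, hI1, Finset.sum_singleton, Finset.sum_insert (by decide),
    Finset.sum_insert (by decide), Finset.sum_singleton]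
  norm_num [inclB]
  rw [h1, h3]
  field_simp
  ring

/-! ### Gradients in phase space by the chain rule along curves -/

/-- `X'` collects the derivatives at `t` of the coordinates of the curve `X`. -/
structure HasVelocity (X : ℝ → Delaunay) (X' : Delaunay) (t : ℝ) : Prop where
  ℓ : HasDerivAt (fun τ => (X τ).ℓ) X'.ℓ t
  g : HasDerivAt (fun τ => (X τ).g) X'.g t
  h : HasDerivAt (fun τ => (X τ).h) X'.h t
  L : HasDerivAt (fun τ => (X τ).L) X'.L t
  G : HasDerivAt (fun τ => (X τ).G) X'.G t
  H : HasDerivAt (fun τ => (X τ).H) X'.H t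

theorem hasVelocity_ℓ (x : Delaunay) :
    HasVelocity (fun t => { x with ℓ := t }) ⟨1, 0, 0, 0, 0, 0⟩ x.ℓ :=
  ⟨hasDerivAt_id _, hasDerivAt_const _ _, hasDerivAt_const _ _, hasDerivAt_const _ _,
    hasDerivAt_const _ _, hasDerivAt_const _ _⟩

theorem hasVelocity_g (x : Delaunay) :
    HasVelocity (fun t => { x with g := t }) ⟨0, 1, 0, 0, 0, 0⟩ x.g :=
  ⟨hasDerivAt_const _ _, hasDerivAt_id _, hasDerivAt_const _ _, hasDerivAt_const _ _,
    hasDerivAt_const _ _, hasDerivAt_const _ _⟩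

theorem hasVelocity_h (x : Delaunay) :
    HasVelocity (fun t => { x with h := t }) ⟨0, 0, 1, 0, 0, 0⟩ x.h :=
  ⟨hasDerivAt_const _ _, hasDerivAt_const _ _, hasDerivAt_id _, hasDerivAt_const _ _,
    hasDerivAt_const _ _, hasDerivAt_const _ _⟩

theorem hasVelocity_L (x : Delaunay) :
    HasVelocity (fun t => { x with L := t }) ⟨0, 0, 0, 1, 0, 0⟩ x.L :=
  ⟨hasDerivAt_const _ _, hasDerivAt_const _ _, hasDerivAt_const _ _, hasDerivAt_id _,
    hasDerivAt_const _ _, hasDerivAt_const _ _⟩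

theorem hasVelocity_G (x : Delaunay) :
    HasVelocity (fun t => { x with G := t }) ⟨0, 0, 0, 0, 1, 0⟩ x.G :=
  ⟨hasDerivAt_const _ _, hasDerivAt_const _ _, hasDerivAt_const _ _, hasDerivAt_const _ _,
    hasDerivAt_id _, hasDerivAt_const _ _⟩

theorem hasVelocity_H (x : Delaunay) :
    HasVelocity (fun t => { x with H := t }) ⟨0, 0, 0, 0, 0, 1⟩ x.H :=
  ⟨hasDerivAt_const _ _, hasDerivAt_const _ _, hasDerivAt_const _ _, hasDerivAt_const _ _,
    hasDerivAt_const _ _, hasDerivAt_id _⟩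

/-- `∂e/∂L` -/
def eccL (x : Delaunay) : ℝ := eta x ^ 2 / (x.L * ecc x)

/-- `∂e/∂G` -/
def eccG (x : Delaunay) : ℝ := -(eta x / (x.L * ecc x))

/-- `∂(sin² I)/∂G` -/
def sinSqG (x : Delaunay) : ℝ := 2 * (1 - sinI x ^ 2) / x.G

/-- `∂(sin² I)/∂H` -/
def sinSqH (x : Delaunay) : ℝ := -(2 * x.H / x.G ^ 2)

/-- `D` collects the partial derivatives of `F` at `x`, which give the derivative of `F` along
every differentiable curve through `x`. -/
def HasGradient (F : Delaunay → ℝ) (D x : Delaunay) : Prop :=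
  ∀ ⦃X : ℝ → Delaunay⦄ ⦃X' : Delaunay⦄ ⦃t : ℝ⦄, HasVelocity X X' t → X t = x →
    HasDerivAt (fun τ => F (X τ))
      (D.ℓ * X'.ℓ + D.g * X'.g + D.h * X'.h + D.L * X'.L + D.G * X'.G + D.H * X'.H) t

section Gradient

variable {F A B : Delaunay → ℝ} {D a b x : Delaunay}

theorem HasGradient.hasDerivAt_ℓ (h : HasGradient F D x) :
    HasDerivAt (fun t => F { x with ℓ := t }) D.ℓ x.ℓ := by
  simpa using h (hasVelocity_ℓ x) rfl

theorem HasGradient.hasDerivAt_g (h : HasGradient F D x) :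
    HasDerivAt (fun t => F { x with g := t }) D.g x.g := by
  simpa using h (hasVelocity_g x) rfl

theorem HasGradient.hasDerivAt_h (h : HasGradient F D x) :
    HasDerivAt (fun t => F { x with h := t }) D.h x.h := by
  simpa using h (hasVelocity_h x) rfl

theorem HasGradient.hasDerivAt_L (h : HasGradient F D x) :
    HasDerivAt (fun t => F { x with L := t }) D.L x.L := by
  simpa using h (hasVelocity_L x) rfl

theorem HasGradient.hasDerivAt_G (h : HasGradient F D x) :
    HasDerivAt (fun t => F { x with G := t }) D.G x.G := by
  simpa using h (hasVelocity_G x) rfl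

theorem HasGradient.hasDerivAt_H (h : HasGradient F D x) :
    HasDerivAt (fun t => F { x with H := t }) D.H x.H := by
  simpa using h (hasVelocity_H x) rfl

theorem HasGradient.hasPartials (h : HasGradient F D x) : HasPartials F x :=
  ⟨h.hasDerivAt_ℓ.differentiableAt, h.hasDerivAt_g.differentiableAt,
    h.hasDerivAt_h.differentiableAt, h.hasDerivAt_L.differentiableAt,
    h.hasDerivAt_G.differentiableAt, h.hasDerivAt_H.differentiableAt⟩

theorem HasGradient.poisson_eq (hA : HasGradient A a x) (hB : HasGradient B b x) :
    poisson A B x = (a.ℓ * b.L - a.L * b.ℓ) + (a.g * b.G - a.G * b.g) +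
      (a.h * b.H - a.H * b.h) := by
  rw [poisson, dℓ, dℓ, dg, dg, dh, dh, dL, dL, dG, dG, dH, dH, hA.hasDerivAt_ℓ.deriv,
    hB.hasDerivAt_ℓ.deriv, hA.hasDerivAt_g.deriv, hB.hasDerivAt_g.deriv, hA.hasDerivAt_h.deriv,
    hB.hasDerivAt_h.deriv, hA.hasDerivAt_L.deriv, hB.hasDerivAt_L.deriv, hA.hasDerivAt_G.deriv,
    hB.hasDerivAt_G.deriv, hA.hasDerivAt_H.deriv, hB.hasDerivAt_H.deriv]

end Gradient

section Curves

variable {X : ℝ → Delaunay} {X' : Delaunay} {t : ℝ}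

/-- The regular domain is open. The closed forms are valid only there, and this allows them to be
differentiated in place of the original definitions. -/
theorem HasVelocity.eventually_regular (hX : HasVelocity X X' t) (hr : (X t).Regular) :
    ∀ᶠ τ in 𝓝 t, (X τ).Regular := by
  have hG := hX.G.continuousAt
  have hL := hX.L.continuousAt
  have hH := hX.H.continuousAt
  filter_upwards [continuousAt_const.eventually_lt hG hr.1, hG.eventually_lt hL hr.2.1,
    hH.abs.eventually_lt hG hr.2.2] with τ h1 h2 h3 using ⟨h1, h2, h3⟩

theorem hasDerivAt_ecc (hX : HasVelocity X X' t) (hr : (X t).Regular) :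
    HasDerivAt (fun τ => ecc (X τ)) (eccL (X t) * X'.L + eccG (X t) * X'.G) t := by
  have hL := hr.L_pos.ne'
  have hpos : 0 < 1 - ((X t).G / (X t).L) ^ 2 := by linarith [hr.div_sq_lt_one]
  refine ((((hX.G.div hX.L hL).pow 2).const_sub 1).sqrt hpos.ne').congr_deriv ?_
  change _ / (2 * ecc (X t)) = _
  have he := (ecc_pos hr).ne'
  simp only [Pi.div_apply, eccL, eccG, eta_eq hr, Nat.add_one_sub_one, pow_one]
  field_simp
  norm_num
  ring

theorem hasDerivAt_sinI_sq (hX : HasVelocity X X' t) (hr : (X t).Regular) :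
    HasDerivAt (fun τ => sinI (X τ) ^ 2) (sinSqG (X t) * X'.G + sinSqH (X t) * X'.H) t := by
  have hG := hr.1.ne'
  have h := ((hX.H.div hX.G hG).pow 2).const_sub 1
  refine (h.congr_of_eventuallyEq ((hX.eventually_regular hr).mono fun τ hτ => ?_)).congr_deriv ?_
  · exact sinI_sq hτ
  · simp only [Pi.div_apply, sinSqG, sinSqH, sinI_sq hr, Nat.add_one_sub_one, pow_one]
    field_simp
    norm_num
    ring

theorem HasVelocity.eventually_noncritical (hX : HasVelocity X X' t) (hr : (X t).Regular)
    (hc : 5 * sinI (X t) ^ 2 ≠ 4) : ∀ᶠ τ in 𝓝 t, 5 * sinI (X τ) ^ 2 ≠ 4 :=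
  ((hasDerivAt_sinI_sq hX hr).continuousAt.const_mul 5).eventually_ne hc

theorem hasDerivAt_anom (hX : HasVelocity X X' t) (hr : (X t).Regular) :
    HasDerivAt (fun τ => anom (X τ))
      (anomEcc (anom (X t)) (ecc (X t)) (eta (X t)) * (eccL (X t) * X'.L + eccG (X t) * X'.G) +
        anomRate (anom (X t)) (ecc (X t)) (eta (X t)) * X'.ℓ) t := by
  have h := hasDerivAt_trueAnomaly (hasDerivAt_ecc hX hr) hX.ℓ (ecc_pos hr) (ecc_lt_one hr)
  refine h.congr_deriv ?_
  rw [← eta_sq hr, sqrt_sq (eta_pos hr).le]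
  rfl

end Curves

/-- The partial derivatives of `ℋ₁₀`. -/
def gradH10 (μ R : ℝ) (x : Delaunay) : Delaunay where
  ℓ := -(μ ^ 4 * R ^ 2 / (2 * x.G ^ 6)) *
    (potF (anom x) (ecc x) x.g (sinI x ^ 2) * anomRate (anom x) (ecc x) (eta x))
  g := -(μ ^ 4 * R ^ 2 / (2 * x.G ^ 6)) * potG (anom x) (ecc x) x.g (sinI x ^ 2)
  h := 0
  L := -(μ ^ 4 * R ^ 2 / (2 * x.G ^ 6)) *
    (potEcc (anom x) (ecc x) (eta x) x.g (sinI x ^ 2) * eccL x)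
  G := -(μ ^ 4 * R ^ 2 / (2 * x.G ^ 6)) *
    (potEcc (anom x) (ecc x) (eta x) x.g (sinI x ^ 2) * eccG x +
      potS (anom x) (ecc x) x.g * sinSqG x - 6 / x.G * pot (anom x) (ecc x) x.g (sinI x ^ 2))
  H := -(μ ^ 4 * R ^ 2 / (2 * x.G ^ 6)) * (potS (anom x) (ecc x) x.g * sinSqH x)

theorem hasGradient_H10 {μ : ℝ} (hμ : 0 < μ) (R : ℝ) {x : Delaunay} (hx : x.Regular) :
    HasGradient (H10 μ R) (gradH10 μ R x) x := by
  rintro X X' t hX rfl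
  have hG := hx.1.ne'
  have h := (((hX.G.pow 6).const_mul 2).fun_inv (mul_ne_zero two_ne_zero (pow_ne_zero 6 hG))
    |>.const_mul (-(μ ^ 4 * R ^ 2))).mul
      (hasDerivAt_pot (hasDerivAt_anom hX hx) (hasDerivAt_ecc hX hx) hX.g (hasDerivAt_sinI_sq hX hx))
  refine (h.congr_of_eventuallyEq ((hX.eventually_regular hx).mono fun τ hτ => ?_)).congr_deriv ?_
  · simp only [Pi.mul_apply, Pi.pow_apply]
    rw [H10_eq hμ R hτ, neg_div', div_eq_mul_inv]
  · simp only [Pi.pow_apply, potEcc, gradH10]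
    field_simp
    ring

/-- The partial derivatives of `𝒲₁`. -/
def gradW1 (μ R : ℝ) (x : Delaunay) : Delaunay where
  ℓ := -(μ ^ 2 * R ^ 2 / (2 * x.G ^ 3)) *
    (genF (anom x) (ecc x) x.g (sinI x ^ 2) * anomRate (anom x) (ecc x) (eta x) -
      (1 - 3 / 2 * sinI x ^ 2))
  g := -(μ ^ 2 * R ^ 2 / (2 * x.G ^ 3)) *
    genG (anom x) (ecc x) x.g (sinI x ^ 2) (constCoeff (sinI x ^ 2))
  h := 0
  L := -(μ ^ 2 * R ^ 2 / (2 * x.G ^ 3)) *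
    (genEcc (anom x) (ecc x) (eta x) x.g (sinI x ^ 2) (constCoeff (sinI x ^ 2)) * eccL x)
  G := -(μ ^ 2 * R ^ 2 / (2 * x.G ^ 3)) *
    (genEcc (anom x) (ecc x) (eta x) x.g (sinI x ^ 2) (constCoeff (sinI x ^ 2)) * eccG x +
      (genS (anom x) x.ℓ (ecc x) x.g - ecc x ^ 2 * sin (2 * x.g) *
        deriv constCoeff (sinI x ^ 2)) * sinSqG x -
      3 / x.G * gen (anom x) x.ℓ (ecc x) x.g (sinI x ^ 2) (constCoeff (sinI x ^ 2)))
  H := -(μ ^ 2 * R ^ 2 / (2 * x.G ^ 3)) *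
    ((genS (anom x) x.ℓ (ecc x) x.g - ecc x ^ 2 * sin (2 * x.g) *
        deriv constCoeff (sinI x ^ 2)) * sinSqH x)

theorem hasGradient_W1 {μ : ℝ} (hμ : 0 < μ) (R : ℝ) {x : Delaunay} (hx : x.Regular)
    (hc : 5 * sinI x ^ 2 ≠ 4) : HasGradient (W1 μ R) (gradW1 μ R x) x := by
  rintro X X' t hX rfl
  have hG := hx.1.ne'
  have hs := hasDerivAt_sinI_sq hX hx
  have hq := (differentiableAt_constCoeff hc).hasDerivAt.comp t hs
  have h := (((hX.G.pow 3).const_mul 2).fun_inv (mul_ne_zero two_ne_zero (pow_ne_zero 3 hG))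
    |>.const_mul (-(μ ^ 2 * R ^ 2))).mul
      (hasDerivAt_gen (hasDerivAt_anom hX hx) hX.ℓ (hasDerivAt_ecc hX hx) hX.g hs hq)
  refine (h.congr_of_eventuallyEq (((hX.eventually_regular hx).and
    (hX.eventually_noncritical hx hc)).mono fun τ hτ => ?_)).congr_deriv ?_
  · simp only [Pi.mul_apply, Pi.pow_apply, Function.comp_apply]
    rw [W1_eq hμ R hτ.1 hτ.2, neg_div', div_eq_mul_inv]
  · simp only [Pi.pow_apply, Function.comp_apply, genEcc, gradW1]
    field_simp
    ring

/-! ### Averages over the mean anomaly -/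

/-- The average of `cos ^ m` over a period. -/
def wallis : ℕ → ℝ
  | 0 => 1
  | 1 => 0
  | m + 2 => (m + 1) / (m + 2) * wallis m

theorem integral_cos_pow_period (m : ℕ) :
    ∫ φ in (0 : ℝ)..(2 * π), cos φ ^ m = 2 * π * wallis m := by
  induction m using Nat.twoStepInduction with
  | zero => simp [wallis]
  | one => simp [wallis]
  | more m ih _ =>
    rw [integral_cos_pow, ih, wallis]
    simp
    ring

theorem integral_sin_mul_cos_pow_period (m : ℕ) :
    ∫ φ in (0 : ℝ)..(2 * π), sin φ * cos φ ^ m = 0 := by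
  have h : ∀ φ ∈ Set.uIcc (0 : ℝ) (2 * π),
      HasDerivAt (fun φ => -(cos φ ^ (m + 1) / (m + 1))) (sin φ * cos φ ^ m) φ := by
    intro φ _
    refine (((hasDerivAt_cos φ).pow (m + 1)).div_const ((m : ℝ) + 1)).fun_neg.congr_deriv ?_
    have : (m : ℝ) + 1 ≠ 0 := by positivity
    push_cast
    field_simp
  rw [intervalIntegral.integral_eq_sub_of_hasDerivAt h
    (Continuous.intervalIntegrable (by fun_prop) _ _)]
  simp

theorem integral_trigPoly {N : ℕ} (a b : Fin N → ℝ) :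
    ∫ φ in (0 : ℝ)..(2 * π), ∑ m, (a m + b m * sin φ) * cos φ ^ (m : ℕ) =
      2 * π * ∑ m, a m * wallis m := by
  rw [intervalIntegral.integral_finsetSum
    fun m _ => Continuous.intervalIntegrable (by fun_prop) _ _, Finset.mul_sum]
  refine Finset.sum_congr rfl fun m _ => ?_
  have h : ∀ φ : ℝ, (a m + b m * sin φ) * cos φ ^ (m : ℕ) =
      a m * cos φ ^ (m : ℕ) + b m * (sin φ * cos φ ^ (m : ℕ)) := fun φ => by ring
  simp only [h]
  rw [intervalIntegral.integral_add (Continuous.intervalIntegrable (by fun_prop) _ _)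
    (Continuous.intervalIntegrable (by fun_prop) _ _), intervalIntegral.integral_const_mul,
    intervalIntegral.integral_const_mul, integral_cos_pow_period, integral_sin_mul_cos_pow_period]
  ring

/-- A true anomaly as a function of the mean anomaly. -/
structure IsAnomaly (f : ℝ → ℝ) (e η : ℝ) : Prop where
  pos : 0 < η
  sq : η ^ 2 = 1 - e ^ 2
  hasDerivAt : ∀ t, HasDerivAt f (anomRate (f t) e η) t
  zero : f 0 = 0
  two_pi : f (2 * π) = 2 * π

theorem isAnomaly_anom {x : Delaunay} (hx : x.Regular) :
    IsAnomaly (fun t => anom { x with ℓ := t }) (ecc x) (eta x) where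
  pos := eta_pos hx
  sq := eta_sq hx
  hasDerivAt t := by
    have h := hasDerivAt_anom (hasVelocity_ℓ { x with ℓ := t }) hx
    refine h.congr_deriv ?_
    simp only [mul_zero, mul_one, add_zero, zero_add]
    rfl
  zero := trueAnomaly_zero (ecc_pos hx).le (ecc_lt_one hx)
  two_pi := trueAnomaly_two_pi (ecc_pos hx).le (ecc_lt_one hx)

theorem IsAnomaly.continuous {f : ℝ → ℝ} {e η : ℝ} (hf : IsAnomaly f e η) : Continuous f :=
  continuous_iff_continuousAt.2 fun t => (hf.hasDerivAt t).continuousAt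

/-- The substitution φ = f(t) has density df/dt = (1 + e cos f)²/η³, which absorbs the factor (1 + e
cos φ)² and leaves a trigonometric polynomial over one turn. Its terms odd in sin φ integrate to
zero. -/
theorem IsAnomaly.integral_eq {f : ℝ → ℝ} {e η : ℝ} (hf : IsAnomaly f e η) {F : ℝ → ℝ} {N : ℕ}
    (a b : Fin N → ℝ)
    (hF : ∀ φ, F φ = (1 + e * cos φ) ^ 2 * ∑ m, (a m + b m * sin φ) * cos φ ^ (m : ℕ)) :
    ∫ t in (0 : ℝ)..(2 * π), F (f t) = 2 * π * (η ^ 3 * ∑ m, a m * wallis m) := by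
  have hη := hf.pos.ne'
  have hc := hf.continuous
  have h1 : ∀ t, F (f t) = η ^ 3 * (((fun φ => ∑ m, (a m + b m * sin φ) * cos φ ^ (m : ℕ)) ∘ f) t *
      anomRate (f t) e η) := by
    intro t
    rw [hF, anomRate, Function.comp_apply]
    generalize ∑ m, (a m + b m * sin (f t)) * cos (f t) ^ (m : ℕ) = y
    field_simp
  have hA : Continuous fun t => anomRate (f t) e η := continuous_anomRate hc
  have hB : Continuous fun φ => ∑ m, (a m + b m * sin φ) * cos φ ^ (m : ℕ) :=
    continuous_finsetSum _ fun m _ =>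
      ((continuous_sin.const_mul (b m)).const_add (a m)).mul (continuous_cos.pow m)
  simp only [h1]
  rw [intervalIntegral.integral_const_mul, intervalIntegral.integral_comp_mul_deriv
    (fun t _ => hf.hasDerivAt t) hA.continuousOn hB, hf.zero, hf.two_pi, integral_trigPoly]
  ring

section Averages

variable {f : ℝ → ℝ} {e η : ℝ}

/-- Differentiation with respect to `e` of the average of `(1 + e cos f) ^ 2 * Q f`. -/
theorem IsAnomaly.integral_leibniz (hf : IsAnomaly f e η) {Q Q' U : ℝ → ℝ}
    (hQ : ∀ φ, HasDerivAt Q (Q' φ) φ) (hQ' : Continuous Q') (hU : Continuous U) :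
    ∫ t in (0 : ℝ)..(2 * π), ((1 + e * cos (f t)) ^ 2 *
        (Q' (f t) * anomEcc (f t) e η + U (f t)) +
      2 * (1 + e * cos (f t)) * Q (f t) * (cos (f t) - e * sin (f t) * anomEcc (f t) e η)) =
    (∫ t in (0 : ℝ)..(2 * π), (1 + e * cos (f t)) ^ 2 * U (f t)) -
      3 * e / η ^ 2 * ∫ t in (0 : ℝ)..(2 * π), (1 + e * cos (f t)) ^ 2 * Q (f t) := by
  have hη := hf.pos.ne'
  have hc := hf.continuous
  have hQc : Continuous Q := continuous_iff_continuousAt.2 fun φ => (hQ φ).continuousAt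
  have hA : Continuous fun t => (1 + e * cos (f t)) ^ 2 * (Q' (f t) * anomEcc (f t) e η + U (f t)) +
      2 * (1 + e * cos (f t)) * Q (f t) * (cos (f t) - e * sin (f t) * anomEcc (f t) e η) := by
    have := hQ'.comp hc
    have := hU.comp hc
    have := hQc.comp hc
    fun_prop
  have hB : Continuous fun t => (1 + e * cos (f t)) ^ 2 * U (f t) := by
    have := hU.comp hc
    fun_prop
  have hC : Continuous fun t => 3 * e / η ^ 2 * ((1 + e * cos (f t)) ^ 2 * Q (f t)) := by
    have := hQc.comp hc
    fun_prop
  rw [← intervalIntegral.integral_const_mul, ← intervalIntegral.integral_sub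
    (hB.intervalIntegrable _ _) (hC.intervalIntegrable _ _), ← sub_eq_zero,
    ← intervalIntegral.integral_sub (hA.intervalIntegrable _ _)
      ((hB.fun_sub hC).intervalIntegrable _ _)]
  -- The primitive is η³ Q ∂f/∂e, with ∂f/∂e taken at constant mean anomaly: the boundary flux in
  -- differentiating η³ ∫ Q df with respect to e. It vanishes at both ends of the period together
  -- with sin f.
  have hd : ∀ t ∈ Set.uIcc (0 : ℝ) (2 * π),
      HasDerivAt (fun t => η * (Q (f t) * (sin (f t) * (2 + e * cos (f t)))))
        ((1 + e * cos (f t)) ^ 2 * (Q' (f t) * anomEcc (f t) e η + U (f t)) +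
          2 * (1 + e * cos (f t)) * Q (f t) * (cos (f t) - e * sin (f t) * anomEcc (f t) e η) -
          ((1 + e * cos (f t)) ^ 2 * U (f t) -
            3 * e / η ^ 2 * ((1 + e * cos (f t)) ^ 2 * Q (f t)))) t := by
    intro t _
    have h := hf.hasDerivAt t
    refine ((((hQ (f t)).comp t h).mul (h.sin.mul ((h.cos.const_mul e).const_add 2))).const_mul
      η).congr_deriv ?_
    have hs := sin_sq_add_cos_sq (f t)
    have hsq := hf.sq
    simp only [Function.comp_apply, anomEcc, anomRate, Pi.mul_apply]
    generalize sin (f t) = S at *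
    generalize cos (f t) = c at *
    field_simp
    linear_combination (Q (f t) * (1 + e * c) * (-2 * c)) * hsq +
      (Q (f t) * (1 + e * c) * e * (-(1 + e * c) + 2 * (2 + e * c))) * hs
  rw [intervalIntegral.integral_eq_sub_of_hasDerivAt hd
    ((hA.sub (hB.fun_sub hC)).intervalIntegrable _ _), hf.zero, hf.two_pi]
  simp

/-- The differentiated function is `pot` with (1 + e cos φ)² divided out, the form of Q required by
`IsAnomaly.integral_leibniz`. -/
theorem hasDerivAt_pot_div (e g s φ : ℝ) :
    HasDerivAt (fun φ => (1 + e * cos φ) * (1 - 3 / 2 * s + 3 / 2 * s * cos (2 * φ + 2 * g)))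
      (-e * sin φ * (1 - 3 / 2 * s + 3 / 2 * s * cos (2 * φ + 2 * g)) -
        3 * s * (1 + e * cos φ) * sin (2 * φ + 2 * g)) φ := by
  have h2 : HasDerivAt (fun τ => 2 * τ + 2 * g) 2 φ := by
    simpa using ((hasDerivAt_id φ).const_mul 2).add_const (2 * g)
  refine ((((hasDerivAt_cos φ).const_mul e).const_add 1).mul
    ((h2.cos.const_mul (3 / 2 * s)).const_add (1 - 3 / 2 * s))).congr_deriv ?_
  ring

theorem hasDerivAt_genG (e g s q φ : ℝ) :
    HasDerivAt (fun φ => genG φ e g s q) (-3 * s * (1 + e * cos φ) * sin (2 * φ + 2 * g)) φ := by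
  have h2 : HasDerivAt (fun τ => 2 * τ + 2 * g) 2 φ := by
    simpa using ((hasDerivAt_id φ).const_mul 2).add_const (2 * g)
  refine ((((h2.cos.const_mul (3 / 2)).add ((((h2.cos.const_mul 2).mul (hasDerivAt_cos φ)).add
    (h2.sin.mul (hasDerivAt_sin φ))).const_mul e)).const_mul s).sub_const
      (2 * q * e ^ 2 * cos (2 * g))).congr_deriv ?_
  ring

/-! ### Explicit averages of products of kernels -/

/-- In this and the following averages the two vectors hold the coefficients of cos^m φ and sin φ
cos^m φ in the integrand divided by (1 + e cos φ)², after the multiple angles are expanded and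
higher powers of sin φ eliminated. Only the first vector contributes, weighted by `wallis`. -/
theorem integral_pot (hf : IsAnomaly f e η) (g s : ℝ) :
    ∫ t in (0 : ℝ)..(2 * π),
      pot (f t) e g s =
      2 * π * (η ^ 3 * (1 - 3 / 2 * s)) := by
  rw [hf.integral_eq (N := 4) (F := fun φ => pot φ e g s)
    ![1 - 3 / 2 * s - 3 / 2 * s * cos (2 * g), e - 3 / 2 * e * s - 3 / 2 * e * s * cos (2 * g), 3
    * s * cos (2 * g), 3 * e * s * cos (2 * g)]
    ![0, -3 * s * sin (2 * g), -3 * e * s * sin (2 * g), 0]]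
  · simp [Fin.sum_univ_succ, wallis, -mul_eq_mul_left_iff]
    ring
  · intro φ
    have hS := sin_sq φ
    simp only [pot]
    simp only [cos_add, sin_two_mul φ, cos_two_mul φ]
    simp [Fin.sum_univ_succ, -mul_eq_mul_left_iff]
    generalize sin (2 * g) = Z
    generalize cos (2 * g) = C
    generalize sin φ = S at *
    generalize cos φ = c at *
    ring

theorem integral_pot_div (hf : IsAnomaly f e η) (g s : ℝ) :
    ∫ t in (0 : ℝ)..(2 * π),
      (1 + e * cos (f t)) ^ 2 * (cos (f t) * (1 - 3 / 2 * s + 3 / 2 * s * cos (2 * f t + 2 * g))) =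
      0 := by
  rw [hf.integral_eq (N := 4) (F := fun φ => (1 + e * cos φ) ^ 2 * (cos φ * (1 - 3 / 2 * s + 3 / 2 * s * cos (2 * φ + 2 * g))))
    ![0, 1 - 3 / 2 * s - 3 / 2 * s * cos (2 * g), 0, 3 * s * cos (2 * g)]
    ![0, 0, -3 * s * sin (2 * g), 0]]
  · simp [Fin.sum_univ_succ, wallis, -mul_eq_mul_left_iff]
  · intro φ
    have hS := sin_sq φ
    simp only [cos_add, sin_two_mul φ, cos_two_mul φ]
    simp [Fin.sum_univ_succ, -mul_eq_mul_left_iff]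
    generalize sin (2 * g) = Z
    generalize cos (2 * g) = C
    generalize sin φ = S at *
    generalize cos φ = c at *
    ring

set_option maxHeartbeats 400000 in
theorem integral_pot_sq (hf : IsAnomaly f e η) (g s : ℝ) :
    ∫ t in (0 : ℝ)..(2 * π),
      pot (f t) e g s ^ 2 =
      2 * π * (η ^ 3 * (1 - 3 * s + 9 / 4 * s ^ 2 + 9 / 8 * s ^ 2 * sin (2 * g) ^ 2 + 9 / 8 * s ^
      2 * cos (2 * g) ^ 2 + 3 * e ^ 2 - 9 * e ^ 2 * s + 9 / 2 * e ^ 2 * s * cos (2 * g) + 27 / 4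
      * e ^ 2 * s ^ 2 + 27 / 8 * e ^ 2 * s ^ 2 * sin (2 * g) ^ 2 - 27 / 4 * e ^ 2 * s ^ 2 * cos
      (2 * g) + 27 / 8 * e ^ 2 * s ^ 2 * cos (2 * g) ^ 2 + 3 / 8 * e ^ 4 - 9 / 8 * e ^ 4 * s + 3
      / 4 * e ^ 4 * s * cos (2 * g) + 27 / 32 * e ^ 4 * s ^ 2 + 45 / 128 * e ^ 4 * s ^ 2 * sin (2
      * g) ^ 2 - 9 / 8 * e ^ 4 * s ^ 2 * cos (2 * g) + 63 / 128 * e ^ 4 * s ^ 2 * cos (2 * g) ^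
      2)) := by
  rw [hf.integral_eq (N := 9) (F := fun φ => pot φ e g s ^ 2)
    ![1 - 3 * s - 3 * s * cos (2 * g) + 9 / 4 * s ^ 2 + 9 / 2 * s ^ 2 * cos (2 * g) + 9 / 4 * s ^
    2 * cos (2 * g) ^ 2, 4 * e - 12 * e * s - 12 * e * s * cos (2 * g) + 9 * e * s ^ 2 + 18 * e *
    s ^ 2 * cos (2 * g) + 9 * e * s ^ 2 * cos (2 * g) ^ 2, 6 * s * cos (2 * g) + 9 * s ^ 2 * sin
    (2 * g) ^ 2 - 9 * s ^ 2 * cos (2 * g) - 9 * s ^ 2 * cos (2 * g) ^ 2 + 6 * e ^ 2 - 18 * e ^ 2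
    * s - 18 * e ^ 2 * s * cos (2 * g) + 27 / 2 * e ^ 2 * s ^ 2 + 27 * e ^ 2 * s ^ 2 * cos (2 *
    g) + 27 / 2 * e ^ 2 * s ^ 2 * cos (2 * g) ^ 2, 24 * e * s * cos (2 * g) + 36 * e * s ^ 2 *
    sin (2 * g) ^ 2 - 36 * e * s ^ 2 * cos (2 * g) - 36 * e * s ^ 2 * cos (2 * g) ^ 2 + 4 * e ^ 3
    - 12 * e ^ 3 * s - 12 * e ^ 3 * s * cos (2 * g) + 9 * e ^ 3 * s ^ 2 + 18 * e ^ 3 * s ^ 2 *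
    cos (2 * g) + 9 * e ^ 3 * s ^ 2 * cos (2 * g) ^ 2, -9 * s ^ 2 * sin (2 * g) ^ 2 + 9 * s ^ 2 *
    cos (2 * g) ^ 2 + 36 * e ^ 2 * s * cos (2 * g) + 54 * e ^ 2 * s ^ 2 * sin (2 * g) ^ 2 - 54 *
    e ^ 2 * s ^ 2 * cos (2 * g) - 54 * e ^ 2 * s ^ 2 * cos (2 * g) ^ 2 + e ^ 4 - 3 * e ^ 4 * s -
    3 * e ^ 4 * s * cos (2 * g) + 9 / 4 * e ^ 4 * s ^ 2 + 9 / 2 * e ^ 4 * s ^ 2 * cos (2 * g) + 9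
    / 4 * e ^ 4 * s ^ 2 * cos (2 * g) ^ 2, -36 * e * s ^ 2 * sin (2 * g) ^ 2 + 36 * e * s ^ 2 *
    cos (2 * g) ^ 2 + 24 * e ^ 3 * s * cos (2 * g) + 36 * e ^ 3 * s ^ 2 * sin (2 * g) ^ 2 - 36 *
    e ^ 3 * s ^ 2 * cos (2 * g) - 36 * e ^ 3 * s ^ 2 * cos (2 * g) ^ 2, -54 * e ^ 2 * s ^ 2 * sin
    (2 * g) ^ 2 + 54 * e ^ 2 * s ^ 2 * cos (2 * g) ^ 2 + 6 * e ^ 4 * s * cos (2 * g) + 9 * e ^ 4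
    * s ^ 2 * sin (2 * g) ^ 2 - 9 * e ^ 4 * s ^ 2 * cos (2 * g) - 9 * e ^ 4 * s ^ 2 * cos (2 * g)
    ^ 2, -36 * e ^ 3 * s ^ 2 * sin (2 * g) ^ 2 + 36 * e ^ 3 * s ^ 2 * cos (2 * g) ^ 2, -9 * e ^ 4
    * s ^ 2 * sin (2 * g) ^ 2 + 9 * e ^ 4 * s ^ 2 * cos (2 * g) ^ 2]
    ![0, -6 * s * sin (2 * g) + 9 * s ^ 2 * sin (2 * g) + 9 * s ^ 2 * cos (2 * g) * sin (2 * g),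
    -24 * e * s * sin (2 * g) + 36 * e * s ^ 2 * sin (2 * g) + 36 * e * s ^ 2 * cos (2 * g) * sin
    (2 * g), -18 * s ^ 2 * cos (2 * g) * sin (2 * g) - 36 * e ^ 2 * s * sin (2 * g) + 54 * e ^ 2
    * s ^ 2 * sin (2 * g) + 54 * e ^ 2 * s ^ 2 * cos (2 * g) * sin (2 * g), -72 * e * s ^ 2 * cos
    (2 * g) * sin (2 * g) - 24 * e ^ 3 * s * sin (2 * g) + 36 * e ^ 3 * s ^ 2 * sin (2 * g) + 36
    * e ^ 3 * s ^ 2 * cos (2 * g) * sin (2 * g), -108 * e ^ 2 * s ^ 2 * cos (2 * g) * sin (2 * g)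
    - 6 * e ^ 4 * s * sin (2 * g) + 9 * e ^ 4 * s ^ 2 * sin (2 * g) + 9 * e ^ 4 * s ^ 2 * cos (2
    * g) * sin (2 * g), -72 * e ^ 3 * s ^ 2 * cos (2 * g) * sin (2 * g), -18 * e ^ 4 * s ^ 2 *
    cos (2 * g) * sin (2 * g), 0]]
  · simp [Fin.sum_univ_succ, wallis, -mul_eq_mul_left_iff]
    ring
  · intro φ
    have hS := sin_sq φ
    simp only [pot]
    simp only [cos_add, sin_two_mul φ, cos_two_mul φ]
    simp [Fin.sum_univ_succ, -mul_eq_mul_left_iff]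
    generalize sin (2 * g) = Z
    generalize cos (2 * g) = C
    generalize sin φ = S at *
    generalize cos φ = c at *
    ring_nf
    simp only [hS]
    ring

set_option maxHeartbeats 400000 in
theorem integral_pot_sq_div (hf : IsAnomaly f e η) (g s : ℝ) :
    ∫ t in (0 : ℝ)..(2 * π),
      (1 + e * cos (f t)) ^ 2 * (2 * cos (f t) * (1 + e * cos (f t)) ^ 3 * (1 - 3 / 2 * s + 3 / 2
      * s * cos (2 * f t + 2 * g)) ^ 2) =
      2 * π * (η ^ 3 * (3 * e - 9 * e * s + 9 / 2 * e * s * cos (2 * g) + 27 / 4 * e * s ^ 2 + 27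
      / 8 * e * s ^ 2 * sin (2 * g) ^ 2 - 27 / 4 * e * s ^ 2 * cos (2 * g) + 27 / 8 * e * s ^ 2 *
      cos (2 * g) ^ 2 + 3 / 4 * e ^ 3 - 9 / 4 * e ^ 3 * s + 3 / 2 * e ^ 3 * s * cos (2 * g) + 27
      / 16 * e ^ 3 * s ^ 2 + 45 / 64 * e ^ 3 * s ^ 2 * sin (2 * g) ^ 2 - 9 / 4 * e ^ 3 * s ^ 2 *
      cos (2 * g) + 63 / 64 * e ^ 3 * s ^ 2 * cos (2 * g) ^ 2)) := by
  rw [hf.integral_eq (N := 9) (F := fun φ => (1 + e * cos φ) ^ 2 * (2 * cos φ * (1 + e * cos φ) ^ 3 * (1 - 3 / 2 * s + 3 / 2 * s * cos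
      (2 * φ + 2 * g)) ^ 2))
    ![0, 2 - 6 * s - 6 * s * cos (2 * g) + 9 / 2 * s ^ 2 + 9 * s ^ 2 * cos (2 * g) + 9 / 2 * s ^
    2 * cos (2 * g) ^ 2, 6 * e - 18 * e * s - 18 * e * s * cos (2 * g) + 27 / 2 * e * s ^ 2 + 27
    * e * s ^ 2 * cos (2 * g) + 27 / 2 * e * s ^ 2 * cos (2 * g) ^ 2, 12 * s * cos (2 * g) + 18 *
    s ^ 2 * sin (2 * g) ^ 2 - 18 * s ^ 2 * cos (2 * g) - 18 * s ^ 2 * cos (2 * g) ^ 2 + 6 * e ^ 2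
    - 18 * e ^ 2 * s - 18 * e ^ 2 * s * cos (2 * g) + 27 / 2 * e ^ 2 * s ^ 2 + 27 * e ^ 2 * s ^ 2
    * cos (2 * g) + 27 / 2 * e ^ 2 * s ^ 2 * cos (2 * g) ^ 2, 36 * e * s * cos (2 * g) + 54 * e *
    s ^ 2 * sin (2 * g) ^ 2 - 54 * e * s ^ 2 * cos (2 * g) - 54 * e * s ^ 2 * cos (2 * g) ^ 2 + 2
    * e ^ 3 - 6 * e ^ 3 * s - 6 * e ^ 3 * s * cos (2 * g) + 9 / 2 * e ^ 3 * s ^ 2 + 9 * e ^ 3 * s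
    ^ 2 * cos (2 * g) + 9 / 2 * e ^ 3 * s ^ 2 * cos (2 * g) ^ 2, -18 * s ^ 2 * sin (2 * g) ^ 2 +
    18 * s ^ 2 * cos (2 * g) ^ 2 + 36 * e ^ 2 * s * cos (2 * g) + 54 * e ^ 2 * s ^ 2 * sin (2 *
    g) ^ 2 - 54 * e ^ 2 * s ^ 2 * cos (2 * g) - 54 * e ^ 2 * s ^ 2 * cos (2 * g) ^ 2, -54 * e * s
    ^ 2 * sin (2 * g) ^ 2 + 54 * e * s ^ 2 * cos (2 * g) ^ 2 + 12 * e ^ 3 * s * cos (2 * g) + 18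
    * e ^ 3 * s ^ 2 * sin (2 * g) ^ 2 - 18 * e ^ 3 * s ^ 2 * cos (2 * g) - 18 * e ^ 3 * s ^ 2 *
    cos (2 * g) ^ 2, -54 * e ^ 2 * s ^ 2 * sin (2 * g) ^ 2 + 54 * e ^ 2 * s ^ 2 * cos (2 * g) ^
    2, -18 * e ^ 3 * s ^ 2 * sin (2 * g) ^ 2 + 18 * e ^ 3 * s ^ 2 * cos (2 * g) ^ 2]
    ![0, 0, -12 * s * sin (2 * g) + 18 * s ^ 2 * sin (2 * g) + 18 * s ^ 2 * cos (2 * g) * sin (2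
    * g), -36 * e * s * sin (2 * g) + 54 * e * s ^ 2 * sin (2 * g) + 54 * e * s ^ 2 * cos (2 * g)
    * sin (2 * g), -36 * s ^ 2 * cos (2 * g) * sin (2 * g) - 36 * e ^ 2 * s * sin (2 * g) + 54 *
    e ^ 2 * s ^ 2 * sin (2 * g) + 54 * e ^ 2 * s ^ 2 * cos (2 * g) * sin (2 * g), -108 * e * s ^
    2 * cos (2 * g) * sin (2 * g) - 12 * e ^ 3 * s * sin (2 * g) + 18 * e ^ 3 * s ^ 2 * sin (2 *
    g) + 18 * e ^ 3 * s ^ 2 * cos (2 * g) * sin (2 * g), -108 * e ^ 2 * s ^ 2 * cos (2 * g) * sin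
    (2 * g), -36 * e ^ 3 * s ^ 2 * cos (2 * g) * sin (2 * g), 0]]
  · simp [Fin.sum_univ_succ, wallis, -mul_eq_mul_left_iff]
    ring
  · intro φ
    have hS := sin_sq φ
    simp only [cos_add, sin_two_mul φ, cos_two_mul φ]
    simp [Fin.sum_univ_succ, -mul_eq_mul_left_iff]
    generalize sin (2 * g) = Z
    generalize cos (2 * g) = C
    generalize sin φ = S at *
    generalize cos φ = c at *
    ring_nf
    simp only [hS]
    ring

theorem integral_genG_mul_pot (hf : IsAnomaly f e η) (g s q : ℝ) :
    ∫ t in (0 : ℝ)..(2 * π),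
      genG (f t) e g s q * pot (f t) e g s =
      2 * π * (η ^ 3 * (9 / 8 * s ^ 2 * sin (2 * g) ^ 2 + 9 / 8 * s ^ 2 * cos (2 * g) ^ 2 - 2 * e
      ^ 2 * q * cos (2 * g) + 3 / 4 * e ^ 2 * s * cos (2 * g) + 3 * e ^ 2 * s * q * cos (2 * g) +
      3 / 4 * e ^ 2 * s ^ 2 * sin (2 * g) ^ 2 - 9 / 8 * e ^ 2 * s ^ 2 * cos (2 * g) + 3 / 4 * e ^
      2 * s ^ 2 * cos (2 * g) ^ 2)) := by
  rw [hf.integral_eq (N := 7) (F := fun φ => genG φ e g s q * pot φ e g s)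
    ![-3 / 2 * s * cos (2 * g) + 9 / 4 * s ^ 2 * cos (2 * g) + 9 / 4 * s ^ 2 * cos (2 * g) ^ 2 -
    2 * e ^ 2 * q * cos (2 * g) + 3 * e ^ 2 * s * q * cos (2 * g) + 3 * e ^ 2 * s * q * cos (2 *
    g) ^ 2, -3 / 2 * e * s * cos (2 * g) + 3 * e * s ^ 2 * sin (2 * g) ^ 2 + 9 / 4 * e * s ^ 2 *
    cos (2 * g) + 9 / 4 * e * s ^ 2 * cos (2 * g) ^ 2 - 2 * e ^ 3 * q * cos (2 * g) + 3 * e ^ 3 *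
    s * q * cos (2 * g) + 3 * e ^ 3 * s * q * cos (2 * g) ^ 2, 3 * s * cos (2 * g) + 9 * s ^ 2 *
    sin (2 * g) ^ 2 - 9 / 2 * s ^ 2 * cos (2 * g) - 9 * s ^ 2 * cos (2 * g) ^ 2 - 6 * e ^ 2 * s *
    q * cos (2 * g) ^ 2 + 3 * e ^ 2 * s ^ 2 * sin (2 * g) ^ 2, 5 * e * s * cos (2 * g) + 12 * e *
    s ^ 2 * sin (2 * g) ^ 2 - 15 / 2 * e * s ^ 2 * cos (2 * g) - 12 * e * s ^ 2 * cos (2 * g) ^ 2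
    - 6 * e ^ 3 * s * q * cos (2 * g) ^ 2, -9 * s ^ 2 * sin (2 * g) ^ 2 + 9 * s ^ 2 * cos (2 * g)
    ^ 2 + 2 * e ^ 2 * s * cos (2 * g) + 3 * e ^ 2 * s ^ 2 * sin (2 * g) ^ 2 - 3 * e ^ 2 * s ^ 2 *
    cos (2 * g) - 3 * e ^ 2 * s ^ 2 * cos (2 * g) ^ 2, -15 * e * s ^ 2 * sin (2 * g) ^ 2 + 15 * e
    * s ^ 2 * cos (2 * g) ^ 2, -6 * e ^ 2 * s ^ 2 * sin (2 * g) ^ 2 + 6 * e ^ 2 * s ^ 2 * cos (2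
    * g) ^ 2]
    ![-e * s * sin (2 * g) + 3 / 2 * e * s ^ 2 * sin (2 * g) + 3 / 2 * e * s ^ 2 * cos (2 * g) *
    sin (2 * g), -3 * s * sin (2 * g) + 9 / 2 * s ^ 2 * sin (2 * g) + 9 * s ^ 2 * cos (2 * g) *
    sin (2 * g) - e ^ 2 * s * sin (2 * g) + 6 * e ^ 2 * s * q * cos (2 * g) * sin (2 * g) + 3 / 2
    * e ^ 2 * s ^ 2 * sin (2 * g) + 3 / 2 * e ^ 2 * s ^ 2 * cos (2 * g) * sin (2 * g), -5 * e * s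
    * sin (2 * g) + 15 / 2 * e * s ^ 2 * sin (2 * g) + 9 * e * s ^ 2 * cos (2 * g) * sin (2 * g)
    + 6 * e ^ 3 * s * q * cos (2 * g) * sin (2 * g), -18 * s ^ 2 * cos (2 * g) * sin (2 * g) - 2
    * e ^ 2 * s * sin (2 * g) + 3 * e ^ 2 * s ^ 2 * sin (2 * g), -30 * e * s ^ 2 * cos (2 * g) *
    sin (2 * g), -12 * e ^ 2 * s ^ 2 * cos (2 * g) * sin (2 * g), 0]]
  · simp [Fin.sum_univ_succ, wallis, -mul_eq_mul_left_iff]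
    ring
  · intro φ
    have hS := sin_sq φ
    -- The product sin(2φ + 2g) sin φ in `genG` contains sin² φ, and the harmonic of `pot` supplies
    -- one more sine, hence the cube.
    have hS3 : sin φ ^ 3 = sin φ * (1 - cos φ ^ 2) := by rw [← hS]; ring
    simp only [genG, pot]
    simp only [cos_add, sin_add, sin_two_mul φ, cos_two_mul φ]
    simp [Fin.sum_univ_succ, -mul_eq_mul_left_iff]
    generalize sin (2 * g) = Z
    generalize cos (2 * g) = C
    generalize sin φ = S at *
    generalize cos φ = c at *
    ring_nf
    simp only [hS, hS3]
    ring

theorem integral_genG_mul_potS (hf : IsAnomaly f e η) (g s q : ℝ) :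
    ∫ t in (0 : ℝ)..(2 * π),
      genG (f t) e g s q * potS (f t) e g =
      2 * π * (η ^ 3 * (9 / 8 * s * sin (2 * g) ^ 2 + 9 / 8 * s * cos (2 * g) ^ 2 + 3 * e ^ 2 * q
      * cos (2 * g) + 3 / 4 * e ^ 2 * s * sin (2 * g) ^ 2 - 9 / 8 * e ^ 2 * s * cos (2 * g) + 3 /
      4 * e ^ 2 * s * cos (2 * g) ^ 2)) := by
  rw [hf.integral_eq (N := 7) (F := fun φ => genG φ e g s q * potS φ e g)
    ![9 / 4 * s * cos (2 * g) + 9 / 4 * s * cos (2 * g) ^ 2 + 3 * e ^ 2 * q * cos (2 * g) + 3 * e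
    ^ 2 * q * cos (2 * g) ^ 2, 3 * e * s * sin (2 * g) ^ 2 + 9 / 4 * e * s * cos (2 * g) + 9 / 4
    * e * s * cos (2 * g) ^ 2 + 3 * e ^ 3 * q * cos (2 * g) + 3 * e ^ 3 * q * cos (2 * g) ^ 2, 9
    * s * sin (2 * g) ^ 2 - 9 / 2 * s * cos (2 * g) - 9 * s * cos (2 * g) ^ 2 - 6 * e ^ 2 * q *
    cos (2 * g) ^ 2 + 3 * e ^ 2 * s * sin (2 * g) ^ 2, 12 * e * s * sin (2 * g) ^ 2 - 15 / 2 * e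
    * s * cos (2 * g) - 12 * e * s * cos (2 * g) ^ 2 - 6 * e ^ 3 * q * cos (2 * g) ^ 2, -9 * s *
    sin (2 * g) ^ 2 + 9 * s * cos (2 * g) ^ 2 + 3 * e ^ 2 * s * sin (2 * g) ^ 2 - 3 * e ^ 2 * s *
    cos (2 * g) - 3 * e ^ 2 * s * cos (2 * g) ^ 2, -15 * e * s * sin (2 * g) ^ 2 + 15 * e * s *
    cos (2 * g) ^ 2, -6 * e ^ 2 * s * sin (2 * g) ^ 2 + 6 * e ^ 2 * s * cos (2 * g) ^ 2]
    ![3 / 2 * e * s * sin (2 * g) + 3 / 2 * e * s * cos (2 * g) * sin (2 * g), 9 / 2 * s * sin (2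
    * g) + 9 * s * cos (2 * g) * sin (2 * g) + 6 * e ^ 2 * q * cos (2 * g) * sin (2 * g) + 3 / 2
    * e ^ 2 * s * sin (2 * g) + 3 / 2 * e ^ 2 * s * cos (2 * g) * sin (2 * g), 15 / 2 * e * s *
    sin (2 * g) + 9 * e * s * cos (2 * g) * sin (2 * g) + 6 * e ^ 3 * q * cos (2 * g) * sin (2 *
    g), -18 * s * cos (2 * g) * sin (2 * g) + 3 * e ^ 2 * s * sin (2 * g), -30 * e * s * cos (2 *
    g) * sin (2 * g), -12 * e ^ 2 * s * cos (2 * g) * sin (2 * g), 0]]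
  · simp [Fin.sum_univ_succ, wallis, -mul_eq_mul_left_iff]
    ring
  · intro φ
    have hS := sin_sq φ
    have hS3 : sin φ ^ 3 = sin φ * (1 - cos φ ^ 2) := by rw [← hS]; ring
    simp only [genG, potS]
    simp only [cos_add, sin_add, sin_two_mul φ, cos_two_mul φ]
    simp [Fin.sum_univ_succ, -mul_eq_mul_left_iff]
    generalize sin (2 * g) = Z
    generalize cos (2 * g) = C
    generalize sin φ = S at *
    generalize cos φ = c at *
    ring_nf
    simp only [hS, hS3]
    ring

theorem integral_genG_mul_pot_div (hf : IsAnomaly f e η) (g s q : ℝ) :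
    ∫ t in (0 : ℝ)..(2 * π),
      (1 + e * cos (f t)) ^ 2 * (genG (f t) e g s q * cos (f t) * (1 - 3 / 2 * s + 3 / 2 * s *
      cos (2 * f t + 2 * g))) =
      2 * π * (η ^ 3 * (3 / 4 * e * s * cos (2 * g) + 3 / 4 * e * s ^ 2 * sin (2 * g) ^ 2 - 9 / 8
      * e * s ^ 2 * cos (2 * g) + 3 / 4 * e * s ^ 2 * cos (2 * g) ^ 2)) := by
  rw [hf.integral_eq (N := 7) (F := fun φ => (1 + e * cos φ) ^ 2 * (genG φ e g s q * cos φ * (1 - 3 / 2 * s + 3 / 2 * s * cos (2 * φ + 2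
      * g))))
    ![0, -3 / 2 * s * cos (2 * g) + 9 / 4 * s ^ 2 * cos (2 * g) + 9 / 4 * s ^ 2 * cos (2 * g) ^ 2
    - 2 * e ^ 2 * q * cos (2 * g) + 3 * e ^ 2 * s * q * cos (2 * g) + 3 * e ^ 2 * s * q * cos (2
    * g) ^ 2, 3 * e * s ^ 2 * sin (2 * g) ^ 2, 3 * s * cos (2 * g) + 9 * s ^ 2 * sin (2 * g) ^ 2
    - 9 / 2 * s ^ 2 * cos (2 * g) - 9 * s ^ 2 * cos (2 * g) ^ 2 - 6 * e ^ 2 * s * q * cos (2 * g)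
    ^ 2, 2 * e * s * cos (2 * g) + 3 * e * s ^ 2 * sin (2 * g) ^ 2 - 3 * e * s ^ 2 * cos (2 * g)
    - 3 * e * s ^ 2 * cos (2 * g) ^ 2, -9 * s ^ 2 * sin (2 * g) ^ 2 + 9 * s ^ 2 * cos (2 * g) ^
    2, -6 * e * s ^ 2 * sin (2 * g) ^ 2 + 6 * e * s ^ 2 * cos (2 * g) ^ 2]
    ![0, -e * s * sin (2 * g) + 3 / 2 * e * s ^ 2 * sin (2 * g) + 3 / 2 * e * s ^ 2 * cos (2 * g)
    * sin (2 * g), -3 * s * sin (2 * g) + 9 / 2 * s ^ 2 * sin (2 * g) + 9 * s ^ 2 * cos (2 * g) *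
    sin (2 * g) + 6 * e ^ 2 * s * q * cos (2 * g) * sin (2 * g), -2 * e * s * sin (2 * g) + 3 * e
    * s ^ 2 * sin (2 * g), -18 * s ^ 2 * cos (2 * g) * sin (2 * g), -12 * e * s ^ 2 * cos (2 * g)
    * sin (2 * g), 0]]
  · simp [Fin.sum_univ_succ, wallis, -mul_eq_mul_left_iff]
    ring
  · intro φ
    have hS := sin_sq φ
    have hS3 : sin φ ^ 3 = sin φ * (1 - cos φ ^ 2) := by rw [← hS]; ring
    simp only [genG]
    simp only [cos_add, sin_add, sin_two_mul φ, cos_two_mul φ]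
    simp [Fin.sum_univ_succ, -mul_eq_mul_left_iff]
    generalize sin (2 * g) = Z
    generalize cos (2 * g) = C
    generalize sin φ = S at *
    generalize cos φ = c at *
    ring_nf
    simp only [hS, hS3]
    ring

/-- This is the remainder that the f-derivative of `genG` leaves in `integral_genG_mul_potEcc`. -/
theorem integral_pot_mul_sin (hf : IsAnomaly f e η) (g s : ℝ) :
    ∫ t in (0 : ℝ)..(2 * π),
      (1 + e * cos (f t)) ^ 2 * ((1 + e * cos (f t)) ^ 2 * sin (2 * f t + 2 * g) * sin (f t) * (2
      + e * cos (f t)) * (1 - 3 / 2 * s + 3 / 2 * s * cos (2 * f t + 2 * g))) =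
      2 * π * (η ^ 3 * (5 / 4 * e * cos (2 * g) - 15 / 8 * e * s * cos (2 * g) + 1 / 8 * e ^ 3 *
      cos (2 * g) - 3 / 64 * e ^ 3 * s * sin (2 * g) ^ 2 - 3 / 16 * e ^ 3 * s * cos (2 * g) + 3 /
      64 * e ^ 3 * s * cos (2 * g) ^ 2)) := by
  rw [hf.integral_eq (N := 9) (F := fun φ => (1 + e * cos φ) ^ 2 * ((1 + e * cos φ) ^ 2 * sin (2 * φ + 2 * g) * sin φ * (2 + e * cos φ)
      * (1 - 3 / 2 * s + 3 / 2 * s * cos (2 * φ + 2 * g))))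
    ![0, 4 * cos (2 * g) + 6 * s * sin (2 * g) ^ 2 - 6 * s * cos (2 * g) - 6 * s * cos (2 * g) ^
    2, 10 * e * cos (2 * g) + 15 * e * s * sin (2 * g) ^ 2 - 15 * e * s * cos (2 * g) - 15 * e *
    s * cos (2 * g) ^ 2, -4 * cos (2 * g) - 18 * s * sin (2 * g) ^ 2 + 6 * s * cos (2 * g) + 18 *
    s * cos (2 * g) ^ 2 + 8 * e ^ 2 * cos (2 * g) + 12 * e ^ 2 * s * sin (2 * g) ^ 2 - 12 * e ^ 2
    * s * cos (2 * g) - 12 * e ^ 2 * s * cos (2 * g) ^ 2, -10 * e * cos (2 * g) - 45 * e * s *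
    sin (2 * g) ^ 2 + 15 * e * s * cos (2 * g) + 45 * e * s * cos (2 * g) ^ 2 + 2 * e ^ 3 * cos
    (2 * g) + 3 * e ^ 3 * s * sin (2 * g) ^ 2 - 3 * e ^ 3 * s * cos (2 * g) - 3 * e ^ 3 * s * cos
    (2 * g) ^ 2, 12 * s * sin (2 * g) ^ 2 - 12 * s * cos (2 * g) ^ 2 - 8 * e ^ 2 * cos (2 * g) -
    36 * e ^ 2 * s * sin (2 * g) ^ 2 + 12 * e ^ 2 * s * cos (2 * g) + 36 * e ^ 2 * s * cos (2 *
    g) ^ 2, 30 * e * s * sin (2 * g) ^ 2 - 30 * e * s * cos (2 * g) ^ 2 - 2 * e ^ 3 * cos (2 * g)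
    - 9 * e ^ 3 * s * sin (2 * g) ^ 2 + 3 * e ^ 3 * s * cos (2 * g) + 9 * e ^ 3 * s * cos (2 * g)
    ^ 2, 24 * e ^ 2 * s * sin (2 * g) ^ 2 - 24 * e ^ 2 * s * cos (2 * g) ^ 2, 6 * e ^ 3 * s * sin
    (2 * g) ^ 2 - 6 * e ^ 3 * s * cos (2 * g) ^ 2]
    ![-2 * sin (2 * g) + 3 * s * sin (2 * g) + 3 * s * cos (2 * g) * sin (2 * g), -5 * e * sin (2
    * g) + 15 / 2 * e * s * sin (2 * g) + 15 / 2 * e * s * cos (2 * g) * sin (2 * g), 4 * sin (2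
    * g) - 6 * s * sin (2 * g) - 24 * s * cos (2 * g) * sin (2 * g) - 4 * e ^ 2 * sin (2 * g) + 6
    * e ^ 2 * s * sin (2 * g) + 6 * e ^ 2 * s * cos (2 * g) * sin (2 * g), 10 * e * sin (2 * g) -
    15 * e * s * sin (2 * g) - 60 * e * s * cos (2 * g) * sin (2 * g) - e ^ 3 * sin (2 * g) + 3 /
    2 * e ^ 3 * s * sin (2 * g) + 3 / 2 * e ^ 3 * s * cos (2 * g) * sin (2 * g), 24 * s * cos (2
    * g) * sin (2 * g) + 8 * e ^ 2 * sin (2 * g) - 12 * e ^ 2 * s * sin (2 * g) - 48 * e ^ 2 * s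
    * cos (2 * g) * sin (2 * g), 60 * e * s * cos (2 * g) * sin (2 * g) + 2 * e ^ 3 * sin (2 * g)
    - 3 * e ^ 3 * s * sin (2 * g) - 12 * e ^ 3 * s * cos (2 * g) * sin (2 * g), 48 * e ^ 2 * s *
    cos (2 * g) * sin (2 * g), 12 * e ^ 3 * s * cos (2 * g) * sin (2 * g), 0]]
  · simp [Fin.sum_univ_succ, wallis, -mul_eq_mul_left_iff]
    ring
  · intro φ
    have hS := sin_sq φ
    have hS3 : sin φ ^ 3 = sin φ * (1 - cos φ ^ 2) := by rw [← hS]; ring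
    simp only [cos_add, sin_add, sin_two_mul φ, cos_two_mul φ]
    simp [Fin.sum_univ_succ, -mul_eq_mul_left_iff]
    generalize sin (2 * g) = Z
    generalize cos (2 * g) = C
    generalize sin φ = S at *
    generalize cos φ = c at *
    ring_nf
    simp only [hS, hS3]
    ring

/-! ### Averages containing derivatives with respect to the eccentricity -/

/-- Apply `IsAnomaly.integral_leibniz` with Q = `pot`/(1 + e cos f)² and U the derivative of Q in e
at constant f; the average of U is zero. -/
theorem integral_potEcc (hf : IsAnomaly f e η) (g s : ℝ) :
    ∫ t in (0 : ℝ)..(2 * π), potEcc (f t) e η g s =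
      2 * π * (-3 * e * η * (1 - 3 / 2 * s)) := by
  have hη := hf.pos.ne'
  have h := hf.integral_leibniz (hasDerivAt_pot_div e g s) (by fun_prop)
    (U := fun φ => cos φ * (1 - 3 / 2 * s + 3 / 2 * s * cos (2 * φ + 2 * g))) (by fun_prop)
  convert h using 1
  · refine intervalIntegral.integral_congr fun t _ => ?_
    simp only [potEcc, potF, potE]
    ring
  · have h1 := integral_pot hf g s
    have h2 := integral_pot_div hf g s
    have e1 : ∀ φ, (1 + e * cos φ) ^ 2 * ((1 + e * cos φ) *
        (1 - 3 / 2 * s + 3 / 2 * s * cos (2 * φ + 2 * g))) = pot φ e g s := fun φ => by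
      rw [pot]
      ring
    simp only [e1]
    rw [h1, h2]
    field_simp
    ring

/-- The integrand is half the e-derivative of `pot` squared at constant mean anomaly, so the exact
derivative applies to Q = `pot`²/(2(1 + e cos f)²). -/
theorem integral_pot_mul_potEcc (hf : IsAnomaly f e η) (g s : ℝ) :
    ∫ t in (0 : ℝ)..(2 * π), pot (f t) e g s * potEcc (f t) e η g s =
      (∫ t in (0 : ℝ)..(2 * π), (1 + e * cos (f t)) ^ 2 * (2 * cos (f t) *
        (1 + e * cos (f t)) ^ 3 *
          (1 - 3 / 2 * s + 3 / 2 * s * cos (2 * f t + 2 * g)) ^ 2)) -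
      3 * e / (2 * η ^ 2) * ∫ t in (0 : ℝ)..(2 * π), pot (f t) e g s ^ 2 := by
  have hη := hf.pos.ne'
  have hd : ∀ φ, HasDerivAt (fun φ => (1 + e * cos φ) ^ 4 *
      (1 - 3 / 2 * s + 3 / 2 * s * cos (2 * φ + 2 * g)) ^ 2 / 2)
      ((1 + e * cos φ) ^ 3 * (1 - 3 / 2 * s + 3 / 2 * s * cos (2 * φ + 2 * g)) *
        (-2 * e * sin φ * (1 - 3 / 2 * s + 3 / 2 * s * cos (2 * φ + 2 * g)) -
          3 * s * (1 + e * cos φ) * sin (2 * φ + 2 * g))) φ := by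
    intro φ
    have h2 : HasDerivAt (fun τ => 2 * τ + 2 * g) 2 φ := by
      simpa using ((hasDerivAt_id φ).const_mul 2).add_const (2 * g)
    refine ((((((hasDerivAt_cos φ).const_mul e).const_add 1).pow 4).mul
      (((h2.cos.const_mul (3 / 2 * s)).const_add (1 - 3 / 2 * s)).pow 2)).div_const 2).congr_deriv ?_
    simp only [Pi.pow_apply]
    push_cast
    ring
  have h := hf.integral_leibniz hd (by fun_prop) (U := fun φ => 2 * cos φ *
    (1 + e * cos φ) ^ 3 * (1 - 3 / 2 * s + 3 / 2 * s * cos (2 * φ + 2 * g)) ^ 2) (by fun_prop)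
  convert h using 1
  · refine intervalIntegral.integral_congr fun t _ => ?_
    simp only [pot, potEcc, potF, potE]
    ring
  · have e1 : ∀ φ, (1 + e * cos φ) ^ 2 * ((1 + e * cos φ) ^ 4 *
        (1 - 3 / 2 * s + 3 / 2 * s * cos (2 * φ + 2 * g)) ^ 2 / 2) = 1 / 2 * pot φ e g s ^ 2 :=
      fun φ => by
        rw [pot]
        ring
    simp only [e1, intervalIntegral.integral_const_mul]
    field_simp

/-- Only the factor `pot` is differentiated in e here. With `genG` included in Q, its f-derivative
times ∂f/∂e appears as an unwanted term, which U is chosen to subtract; this produces the last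
integral. -/
theorem integral_genG_mul_potEcc (hf : IsAnomaly f e η) (g s q : ℝ) :
    ∫ t in (0 : ℝ)..(2 * π), genG (f t) e g s q * potEcc (f t) e η g s =
      (∫ t in (0 : ℝ)..(2 * π), (1 + e * cos (f t)) ^ 2 * (genG (f t) e g s q * cos (f t) *
        (1 - 3 / 2 * s + 3 / 2 * s * cos (2 * f t + 2 * g)))) -
      3 * e / η ^ 2 * (∫ t in (0 : ℝ)..(2 * π), genG (f t) e g s q * pot (f t) e g s) +
      3 * s / η ^ 2 * ∫ t in (0 : ℝ)..(2 * π), (1 + e * cos (f t)) ^ 2 *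
        ((1 + e * cos (f t)) ^ 2 * sin (2 * f t + 2 * g) * sin (f t) * (2 + e * cos (f t)) *
          (1 - 3 / 2 * s + 3 / 2 * s * cos (2 * f t + 2 * g))) := by
  have hη := hf.pos.ne'
  have hc := hf.continuous
  have h := hf.integral_leibniz
    (fun φ => (hasDerivAt_genG e g s q φ).mul (hasDerivAt_pot_div e g s φ))
    (by fun_prop) (U := fun φ => genG φ e g s q * cos φ *
      (1 - 3 / 2 * s + 3 / 2 * s * cos (2 * φ + 2 * g)) -
      -3 * s * (1 + e * cos φ) * sin (2 * φ + 2 * g) *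
        ((1 + e * cos φ) * (1 - 3 / 2 * s + 3 / 2 * s * cos (2 * φ + 2 * g))) *
          anomEcc φ e η) (by fun_prop)
  convert h using 1
  · refine intervalIntegral.integral_congr fun t _ => ?_
    simp only [potEcc, potF, potE, Pi.mul_apply]
    ring
  · have e1 : ∀ φ, (1 + e * cos φ) ^ 2 * ((fun φ => genG φ e g s q) * fun φ =>
        (1 + e * cos φ) * (1 - 3 / 2 * s + 3 / 2 * s * cos (2 * φ + 2 * g))) φ =
        genG φ e g s q * pot φ e g s := fun φ => by
      simp only [pot, Pi.mul_apply]
      ring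
    simp only [e1]
    have e2 : ∀ φ, (1 + e * cos φ) ^ 2 * (genG φ e g s q * cos φ *
        (1 - 3 / 2 * s + 3 / 2 * s * cos (2 * φ + 2 * g)) -
        -3 * s * (1 + e * cos φ) * sin (2 * φ + 2 * g) *
          ((1 + e * cos φ) * (1 - 3 / 2 * s + 3 / 2 * s * cos (2 * φ + 2 * g))) *
            anomEcc φ e η) =
        (1 + e * cos φ) ^ 2 * (genG φ e g s q * cos φ *
          (1 - 3 / 2 * s + 3 / 2 * s * cos (2 * φ + 2 * g))) +
        3 * s / η ^ 2 * ((1 + e * cos φ) ^ 2 *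
          ((1 + e * cos φ) ^ 2 * sin (2 * φ + 2 * g) * sin φ * (2 + e * cos φ) *
            (1 - 3 / 2 * s + 3 / 2 * s * cos (2 * φ + 2 * g)))) := fun φ => by
      simp only [anomEcc]
      ring
    have hA : Continuous fun t => (1 + e * cos (f t)) ^ 2 * (genG (f t) e g s q * cos (f t) *
        (1 - 3 / 2 * s + 3 / 2 * s * cos (2 * f t + 2 * g))) := by fun_prop
    have hB : Continuous fun t => 3 * s / η ^ 2 * ((1 + e * cos (f t)) ^ 2 *
        ((1 + e * cos (f t)) ^ 2 * sin (2 * f t + 2 * g) * sin (f t) * (2 + e * cos (f t)) *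
          (1 - 3 / 2 * s + 3 / 2 * s * cos (2 * f t + 2 * g)))) := by fun_prop
    simp only [e2]
    rw [intervalIntegral.integral_add (hA.intervalIntegrable _ _) (hB.intervalIntegrable _ _),
      intervalIntegral.integral_const_mul]
    ring

end Averages

/-! ### The first order average -/

theorem H01_eq {μ : ℝ} (hμ : 0 < μ) (R : ℝ) {x : Delaunay} (hx : x.Regular) :
    H01 μ R x = -(μ ^ 4 * R ^ 2 / (2 * x.G ^ 6)) * (eta x ^ 3 * (1 - 3 / 2 * sinI x ^ 2)) := by
  have h : ∀ t, H10 μ R { x with ℓ := t } = -(μ ^ 4 * R ^ 2 / (2 * x.G ^ 6)) *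
      pot (anom { x with ℓ := t }) (ecc x) x.g (sinI x ^ 2) :=
    fun t => H10_eq hμ R (x := { x with ℓ := t }) hx
  rw [H01, average]
  simp only [h]
  rw [intervalIntegral.integral_const_mul, integral_pot (isAnomaly_anom hx)]
  field_simp

/-- The partial derivatives of `ℋ₀₁`. -/
def gradH01 (μ R : ℝ) (x : Delaunay) : Delaunay where
  ℓ := 0
  g := 0
  h := 0
  L := μ ^ 4 * R ^ 2 / (2 * x.G ^ 6) * eta x ^ 3 * (3 / x.L * (1 - 3 / 2 * sinI x ^ 2))
  G := μ ^ 4 * R ^ 2 / (2 * x.G ^ 6) * eta x ^ 3 *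
    (3 / x.G * (1 - 3 / 2 * sinI x ^ 2) + 3 / 2 * sinSqG x)
  H := μ ^ 4 * R ^ 2 / (2 * x.G ^ 6) * eta x ^ 3 * (3 / 2 * sinSqH x)

theorem hasGradient_H01 {μ : ℝ} (hμ : 0 < μ) (R : ℝ) {x : Delaunay} (hx : x.Regular) :
    HasGradient (H01 μ R) (gradH01 μ R x) x := by
  rintro X X' t hX rfl
  have hG := hx.1.ne'
  have hL := hx.L_pos.ne'
  have hs := hasDerivAt_sinI_sq hX hx
  have h := (((hX.G.pow 3).mul (hX.L.pow 3)).fun_inv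
    (mul_ne_zero (pow_ne_zero 3 hG) (pow_ne_zero 3 hL)) |>.const_mul (-(μ ^ 4 * R ^ 2 / 2))).mul
      ((hs.const_mul (3 / 2)).const_sub 1)
  refine (h.congr_of_eventuallyEq ((hX.eventually_regular hx).mono fun τ hτ => ?_)).congr_deriv ?_
  · have hG := hτ.1.ne'
    have hL := hτ.L_pos.ne'
    simp only [Pi.mul_apply, Pi.pow_apply]
    rw [H01_eq hμ R hτ, eta_eq hτ]
    field_simp
  · simp only [Pi.mul_apply, Pi.pow_apply, gradH01, eta_eq hx]
    field_simp
    ring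

/-- The first homological equation: `genF` carries one factor 1 + e cos f and ∂f/∂ℓ carries two,
which together restore the cube in `pot`; the term -ℓ of the equation of the center supplies the
average. -/
theorem gradW1_ℓ {μ : ℝ} (hμ : 0 < μ) (R : ℝ) {x : Delaunay} (hx : x.Regular) :
    (gradW1 μ R x).ℓ = (H10 μ R x - H01 μ R x) / meanMotion μ x := by
  have hG := hx.1.ne'
  have hL := hx.L_pos.ne'
  rw [H10_eq hμ R hx, H01_eq hμ R hx, meanMotion]
  simp only [gradW1, genF, anomRate, pot, eta_eq hx]
  field_simp
  ring

/-! ### The second order average -/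

theorem Htilde02_eq {μ : ℝ} (hμ : 0 < μ) (R : ℝ) {x : Delaunay} (hx : x.Regular)
    (hc : 5 * sinI x ^ 2 ≠ 4) :
    Htilde02 μ R x =
      (gradH10 μ R x).ℓ * (gradW1 μ R x).L -
        ((gradH10 μ R x).L + (gradH01 μ R x).L) * (gradW1 μ R x).ℓ +
      ((gradH10 μ R x).g * (gradW1 μ R x).G -
        ((gradH10 μ R x).G + (gradH01 μ R x).G) * (gradW1 μ R x).g) := by
  rw [Htilde02, (hasGradient_H10 hμ R hx).poisson_eq (hasGradient_W1 hμ R hx hc),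
    (hasGradient_H01 hμ R hx).poisson_eq (hasGradient_W1 hμ R hx hc)]
  simp only [gradH10, gradH01, gradW1]
  ring

section Slice

variable (x : Delaunay) (t : ℝ)

theorem ecc_slice : ecc { x with ℓ := t } = ecc x := rfl
theorem eta_slice : eta { x with ℓ := t } = eta x := rfl
theorem sinI_slice : sinI { x with ℓ := t } = sinI x := rfl
theorem eccL_slice : eccL { x with ℓ := t } = eccL x := rfl
theorem eccG_slice : eccG { x with ℓ := t } = eccG x := rfl
theorem sinSqG_slice : sinSqG { x with ℓ := t } = sinSqG x := rfl

end Slice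

theorem continuous_Htilde02 {μ : ℝ} (hμ : 0 < μ) (R : ℝ) {x : Delaunay} (hx : x.Regular)
    (hc : 5 * sinI x ^ 2 ≠ 4) : Continuous fun t => Htilde02 μ R { x with ℓ := t } := by
  have hf := (isAnomaly_anom hx).continuous
  have h : ∀ t, Htilde02 μ R { x with ℓ := t } = _ :=
    fun t => Htilde02_eq hμ R (x := { x with ℓ := t }) hx hc
  simp only [h, gradH10, gradH01, gradW1, ecc_slice, eta_slice, sinI_slice, eccL_slice,
    eccG_slice, sinSqG_slice]
  generalize hF : (fun t => anom { x with ℓ := t }) = f at hf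
  have hF' : ∀ t, anom { x with ℓ := t } = f t := fun t => congrFun hF t
  simp only [hF']
  fun_prop

/-! ### Derivatives of the kernels in ℓ and the integration by parts -/

section Primitive

variable {f : ℝ → ℝ} {e η : ℝ}

theorem IsAnomaly.hasDerivAt_pot (hf : IsAnomaly f e η) (g s t : ℝ) :
    HasDerivAt (fun t => pot (f t) e g s) (potF (f t) e g s * anomRate (f t) e η) t := by
  refine (Brouwer.hasDerivAt_pot (hf.hasDerivAt t) (hasDerivAt_const t e) (hasDerivAt_const t g)
    (hasDerivAt_const t s)).congr_deriv ?_
  ring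

theorem IsAnomaly.hasDerivAt_gen (hf : IsAnomaly f e η) (g s q t : ℝ) :
    HasDerivAt (fun t => gen (f t) t e g s q) (pot (f t) e g s / η ^ 3 - (1 - 3 / 2 * s)) t := by
  refine (Brouwer.hasDerivAt_gen (hf.hasDerivAt t) (hasDerivAt_id t) (hasDerivAt_const t e)
    (hasDerivAt_const t g) (hasDerivAt_const t s) (hasDerivAt_const t q)).congr_deriv ?_
  simp only [genF, anomRate, pot]
  ring

theorem IsAnomaly.hasDerivAt_genG (hf : IsAnomaly f e η) (g s q t : ℝ) :
    HasDerivAt (fun t => genG (f t) e g s q) (potG (f t) e g s / η ^ 3) t := by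
  refine ((Brouwer.hasDerivAt_genG e g s q (f t)).comp t (hf.hasDerivAt t)).congr_deriv ?_
  simp only [anomRate, potG]
  ring

theorem IsAnomaly.hasDerivAt_genS (hf : IsAnomaly f e η) (g t : ℝ) :
    HasDerivAt (fun t => genS (f t) t e g) (potS (f t) e g / η ^ 3 + 3 / 2) t := by
  -- `gen` is affine in s, so its s-derivative is the difference of its values at s = 1 and s = 0; q
  -- = 0 discards the integration constant.
  have h := (hf.hasDerivAt_gen g 1 0 t).sub (hf.hasDerivAt_gen g 0 0 t)
  refine (h.congr_of_eventuallyEq (Eventually.of_forall fun τ => ?_)).congr_deriv ?_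
  · simp only [gen, genS, Pi.sub_apply]
    ring
  · simp only [pot, potS]
    ring

/-- Equality of the mixed derivatives in ℓ and e, checked directly: the result is the e-derivative
of `pot`/η³, and 3e/η⁵ is the derivative of η⁻³. -/
theorem IsAnomaly.hasDerivAt_genEcc (hf : IsAnomaly f e η) (g s q t : ℝ) :
    HasDerivAt (fun t => genEcc (f t) e η g s q)
      (potEcc (f t) e η g s / η ^ 3 + 3 * e * pot (f t) e g s / η ^ 5) t := by
  have hη := hf.pos.ne'
  have h := hf.hasDerivAt t
  have h2 : HasDerivAt (fun t => 2 * f t + 2 * g) (2 * anomRate (f t) e η) t :=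
    (h.const_mul 2).add_const _
  have hF := ((h.cos.const_mul e).const_add 1).mul ((h2.cos.const_mul (3 / 2 * s)).const_add
    (1 - 3 / 2 * s))
  have hE := (h.sin.mul ((h.cos.const_mul e).const_add 2)).div_const (η ^ 2)
  have hG := ((h.sin.const_mul (1 - 3 / 2 * s)).add (((h2.sin.mul h.cos).sub
    ((h2.cos.mul h.sin).div_const 2)).const_mul s)).sub_const (2 * q * e * sin (2 * g))
  refine ((hF.mul hE).add hG).congr_deriv ?_
  have hs := sin_sq_add_cos_sq (f t)
  have hsq := hf.sq
  simp only [potEcc, potF, potE, pot, anomEcc, anomRate, Pi.mul_apply]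
  generalize sin (2 * f t + 2 * g) = v
  generalize cos (2 * f t + 2 * g) = u
  generalize sin (f t) = S at *
  generalize cos (f t) = c at *
  field_simp
  linear_combination (2 * (1 + e * c) ^ 2 * (1 - 3 / 2 * s + 3 / 2 * s * u)) *
    (e * (3 + e * c) * hs - 2 * c * hsq)

end Primitive

theorem genF_mul_anomRate (f e η g s : ℝ) :
    genF f e g s * anomRate f e η = pot f e g s / η ^ 3 := by
  simp only [genF, anomRate, pot]
  ring

/-- A primitive of the part of `H̃₀₂` that averages to zero, as a function of the true and the
mean anomalies. -/
def oscPrimitive (μ R : ℝ) (x : Delaunay) (f ℓ : ℝ) : ℝ :=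
  μ ^ 4 * R ^ 2 / (2 * x.G ^ 6) * (μ ^ 2 * R ^ 2 / (2 * x.G ^ 3)) *
    ((pot f (ecc x) x.g (sinI x ^ 2) - eta x ^ 3 * (1 - 3 / 2 * sinI x ^ 2)) *
        (genEcc f (ecc x) (eta x) x.g (sinI x ^ 2) (constCoeff (sinI x ^ 2)) * eccL x) +
      eta x ^ 3 * genG f (ecc x) x.g (sinI x ^ 2) (constCoeff (sinI x ^ 2)) *
        (genEcc f (ecc x) (eta x) x.g (sinI x ^ 2) (constCoeff (sinI x ^ 2)) * eccG x +
          (genS f ℓ (ecc x) x.g - ecc x ^ 2 * sin (2 * x.g) *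
            deriv constCoeff (sinI x ^ 2)) * sinSqG x -
          3 / x.G * gen f ℓ (ecc x) x.g (sinI x ^ 2) (constCoeff (sinI x ^ 2))))

/-- The remaining part of `H̃₀₂`. -/
def secPart (μ R : ℝ) (x : Delaunay) (f : ℝ) : ℝ :=
  -((μ ^ 4 * R ^ 2 / (2 * x.G ^ 6)) ^ 2 / meanMotion μ x) *
      ((pot f (ecc x) x.g (sinI x ^ 2) - eta x ^ 3 * (1 - 3 / 2 * sinI x ^ 2)) *
        (2 * eccL x * potEcc f (ecc x) (eta x) x.g (sinI x ^ 2) +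
          3 / x.L * (pot f (ecc x) x.g (sinI x ^ 2) - eta x ^ 3 * (1 - 3 / 2 * sinI x ^ 2)))) -
    2 * (μ ^ 2 * R ^ 2 / (2 * x.G ^ 3)) * (μ ^ 4 * R ^ 2 / (2 * x.G ^ 6)) *
      (genG f (ecc x) x.g (sinI x ^ 2) (constCoeff (sinI x ^ 2)) *
        (eccG x * potEcc f (ecc x) (eta x) x.g (sinI x ^ 2) + sinSqG x * potS f (ecc x) x.g -
          6 / x.G * pot f (ecc x) x.g (sinI x ^ 2)))

/-- The primitive is (ℋ₁₀ - ℋ₀₁) ∂𝒲₁/∂L + n ∂𝒲₁/∂g ∂𝒲₁/∂G. Differentiating the homological equation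
in g, L and G gives the mixed derivatives of 𝒲₁; that in L also brings 3/L, as n varies like L⁻³.
The derivatives of ℋ₀₁ cancel, leaving -(ℋ₁₀ - ℋ₀₁)(2 ∂ℋ₁₀/∂L + (3/L)(ℋ₁₀ - ℋ₀₁))/n - 2 ∂ℋ₁₀/∂G
∂𝒲₁/∂g, without the equation of the center. -/
theorem hasDerivAt_oscPrimitive {μ : ℝ} (hμ : 0 < μ) (R : ℝ) {x : Delaunay} (hx : x.Regular)
    (hc : 5 * sinI x ^ 2 ≠ 4) (t : ℝ) :
    HasDerivAt (fun t => oscPrimitive μ R x (anom { x with ℓ := t }) t)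
      (Htilde02 μ R { x with ℓ := t } - secPart μ R x (anom { x with ℓ := t })) t := by
  have hf := isAnomaly_anom hx
  rw [Htilde02_eq hμ R (x := { x with ℓ := t }) hx hc]
  simp only [gradH10, gradH01, gradW1, ecc_slice, eta_slice, sinI_slice, eccL_slice,
    eccG_slice, sinSqG_slice, genF_mul_anomRate]
  generalize hF : (fun t => anom { x with ℓ := t }) = f at hf
  have hF' : ∀ t, anom { x with ℓ := t } = f t := fun t => congrFun hF t
  simp only [hF']
  clear hF hF'
  have hE := hf.hasDerivAt_genEcc x.g (sinI x ^ 2) (constCoeff (sinI x ^ 2)) t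
  have h := ((((hf.hasDerivAt_pot x.g (sinI x ^ 2) t).sub_const
      (eta x ^ 3 * (1 - 3 / 2 * sinI x ^ 2))).mul (hE.mul_const (eccL x))).add
    (((hf.hasDerivAt_genG x.g (sinI x ^ 2) (constCoeff (sinI x ^ 2)) t).const_mul
      (eta x ^ 3)).mul (((hE.mul_const (eccG x)).add (((hf.hasDerivAt_genS x.g t).sub_const
        (ecc x ^ 2 * sin (2 * x.g) * deriv constCoeff (sinI x ^ 2))).mul_const (sinSqG x))).sub
      ((hf.hasDerivAt_gen x.g (sinI x ^ 2) (constCoeff (sinI x ^ 2)) t).const_mul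
        (3 / x.G))))).const_mul
    (μ ^ 4 * R ^ 2 / (2 * x.G ^ 6) * (μ ^ 2 * R ^ 2 / (2 * x.G ^ 3)))
  refine h.congr_deriv ?_
  have hL := hx.L_pos.ne'
  have hη := hf.pos.ne'
  have he := (ecc_pos hx).ne'
  have hG : x.G = eta x * x.L := by
    rw [eta_eq hx]
    field_simp
  simp only [secPart, eccL, eccG, sinSqG, meanMotion, hG, Pi.add_apply, Pi.sub_apply]
  generalize potF (f t) (ecc x) x.g (sinI x ^ 2) = JF
  generalize potEcc (f t) (ecc x) (eta x) x.g (sinI x ^ 2) = JE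
  generalize pot (f t) (ecc x) x.g (sinI x ^ 2) = J
  generalize potG (f t) (ecc x) x.g (sinI x ^ 2) = JG
  generalize potS (f t) (ecc x) x.g = JS
  generalize genEcc (f t) (ecc x) (eta x) x.g (sinI x ^ 2) (constCoeff (sinI x ^ 2)) = KE
  generalize genG (f t) (ecc x) x.g (sinI x ^ 2) (constCoeff (sinI x ^ 2)) = KG
  generalize genS (f t) t (ecc x) x.g = KS
  generalize gen (f t) t (ecc x) x.g (sinI x ^ 2) (constCoeff (sinI x ^ 2)) = K
  generalize anomRate (f t) (ecc x) (eta x) = r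
  generalize deriv constCoeff (sinI x ^ 2) = q'
  generalize sin (2 * x.g) = Z
  generalize sinI x ^ 2 = s
  generalize ecc x = e at *
  generalize eta x = η at *
  generalize x.L = L at *
  field_simp
  ring

/-- Since f = ℓ at both ends of the period, `gen` and `genS` return to their initial values and so
does `oscPrimitive`; the exact derivative does not contribute. -/
theorem integral_Htilde02 {μ : ℝ} (hμ : 0 < μ) (R : ℝ) {x : Delaunay} (hx : x.Regular)
    (hc : 5 * sinI x ^ 2 ≠ 4) :
    ∫ t in (0 : ℝ)..(2 * π), Htilde02 μ R { x with ℓ := t } =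
      ∫ t in (0 : ℝ)..(2 * π), secPart μ R x (anom { x with ℓ := t }) := by
  have hH := continuous_Htilde02 hμ R hx hc
  have hS : Continuous fun t => secPart μ R x (anom { x with ℓ := t }) := by
    have hf := (isAnomaly_anom hx).continuous
    unfold secPart
    generalize hF : (fun t => anom { x with ℓ := t }) = f at hf
    have hF' : ∀ t, anom { x with ℓ := t } = f t := fun t => congrFun hF t
    simp only [hF']
    fun_prop
  rw [← sub_eq_zero, ← intervalIntegral.integral_sub (hH.intervalIntegrable _ _)
    (hS.intervalIntegrable _ _), intervalIntegral.integral_eq_sub_of_hasDerivAt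
      (fun t _ => hasDerivAt_oscPrimitive hμ R hx hc t)
      ((hH.fun_sub hS).intervalIntegrable _ _)]
  have h0 := (isAnomaly_anom hx).zero
  have h1 := (isAnomaly_anom hx).two_pi
  rw [h0, h1]
  have hs : sin (2 * (2 * π) + 2 * x.g) = sin (2 * 0 + 2 * x.g) := by
    rw [show 2 * (2 * π) + 2 * x.g = 2 * 0 + 2 * x.g + (2 : ℕ) * (2 * π) by push_cast; ring,
      sin_add_nat_mul_two_pi]
  have hcs : cos (2 * (2 * π) + 2 * x.g) = cos (2 * 0 + 2 * x.g) := by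
    rw [show 2 * (2 * π) + 2 * x.g = 2 * 0 + 2 * x.g + (2 : ℕ) * (2 * π) by push_cast; ring,
      cos_add_nat_mul_two_pi]
  simp only [oscPrimitive, pot, genEcc, genF, genE, genG, genS, gen, anomEcc, hs, hcs,
    cos_two_pi, sin_two_pi, cos_zero, sin_zero]
  ring

/-- The second order normalized Hamiltonian in closed form. -/
theorem H02_eq {μ : ℝ} (hμ : 0 < μ) (R : ℝ) {x : Delaunay} (hx : x.Regular)
    (hc : 5 * sinI x ^ 2 ≠ 4) :
    H02 μ R x = (μ ^ 4 * R ^ 2 / (2 * x.G ^ 6)) ^ 2 / (meanMotion μ x * x.L) *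
      (eta x ^ 5 * (-6 + 27 / 2 * sinI x ^ 2 - 15 / 2 * sinI x ^ 4 +
        ecc x ^ 2 * (-3 / 2 + 3 / 2 * sinI x ^ 2 + 15 / 16 * sinI x ^ 4) +
        ecc x ^ 2 * cos (2 * x.g) * (sinI x ^ 2 * (21 / 4 - 45 / 8 * sinI x ^ 2) +
          6 * constCoeff (sinI x ^ 2) * (5 * sinI x ^ 2 - 4))) -
        3 * eta x ^ 6 * (1 - 3 / 2 * sinI x ^ 2) ^ 2) := by
  rw [H02, average, integral_Htilde02 hμ R hx hc]
  have hf := isAnomaly_anom hx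
  generalize hF : (fun t => anom { x with ℓ := t }) = f at hf
  have hF' : ∀ t, anom { x with ℓ := t } = f t := fun t => congrFun hF t
  simp only [hF']
  clear hF hF'
  have hfc := hf.continuous
  have hL := hx.L_pos.ne'
  have hη := hf.pos.ne'
  have he := (ecc_pos hx).ne'
  have hπ := pi_ne_zero
  have hμ' := hμ.ne'
  have hsq := hf.sq
  have hG : x.G = eta x * x.L := by
    rw [eta_eq hx]
    field_simp
  -- The remainder is split into the products whose averages are known. The divisors e come from
  -- ∂e/∂L and ∂e/∂G, and cancel because every average containing `potEcc` is proportional to e.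
  have hexp : ∀ t, secPart μ R x (f t) =
      (μ ^ 4 * R ^ 2 / (2 * x.G ^ 6)) ^ 2 / (meanMotion μ x * x.L) *
      (-2 * eta x ^ 2 / ecc x * (pot (f t) (ecc x) x.g (sinI x ^ 2) *
          potEcc (f t) (ecc x) (eta x) x.g (sinI x ^ 2)) +
        -3 * pot (f t) (ecc x) x.g (sinI x ^ 2) ^ 2 +
        6 * eta x ^ 3 * (1 - 3 / 2 * sinI x ^ 2) * pot (f t) (ecc x) x.g (sinI x ^ 2) +
        2 * eta x ^ 5 / ecc x * (1 - 3 / 2 * sinI x ^ 2) *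
          potEcc (f t) (ecc x) (eta x) x.g (sinI x ^ 2) +
        -3 * eta x ^ 6 * (1 - 3 / 2 * sinI x ^ 2) ^ 2 +
        2 * eta x ^ 4 / ecc x * (genG (f t) (ecc x) x.g (sinI x ^ 2) (constCoeff (sinI x ^ 2)) *
          potEcc (f t) (ecc x) (eta x) x.g (sinI x ^ 2)) +
        -4 * eta x ^ 2 * (1 - sinI x ^ 2) *
          (genG (f t) (ecc x) x.g (sinI x ^ 2) (constCoeff (sinI x ^ 2)) *
            potS (f t) (ecc x) x.g) +
        12 * eta x ^ 2 * (genG (f t) (ecc x) x.g (sinI x ^ 2) (constCoeff (sinI x ^ 2)) *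
          pot (f t) (ecc x) x.g (sinI x ^ 2))) := by
    intro t
    simp only [secPart, eccL, eccG, sinSqG, meanMotion, hG]
    field_simp
    ring
  simp only [hexp]
  rw [intervalIntegral.integral_const_mul, intervalIntegral.integral_add,
    intervalIntegral.integral_add, intervalIntegral.integral_add, intervalIntegral.integral_add,
    intervalIntegral.integral_add, intervalIntegral.integral_add, intervalIntegral.integral_add]
  · simp only [intervalIntegral.integral_const_mul, intervalIntegral.integral_const]
    rw [integral_pot_mul_potEcc hf, integral_pot_sq_div hf, integral_pot_sq hf, integral_pot hf,
      integral_potEcc hf, integral_genG_mul_potEcc hf, integral_genG_mul_pot_div hf,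
      integral_genG_mul_pot hf, integral_pot_mul_sin hf, integral_genG_mul_potS hf]
    have hZ := sin_sq (2 * x.g)
    have hs4 : sinI x ^ 4 = (sinI x ^ 2) ^ 2 := by ring
    rw [hs4]
    simp only [hZ, sub_zero, smul_eq_mul]
    generalize (μ ^ 4 * R ^ 2 / (2 * x.G ^ 6)) ^ 2 / (meanMotion μ x * x.L) = k
    generalize constCoeff (sinI x ^ 2) = q
    generalize cos (2 * x.g) = C
    generalize sinI x ^ 2 = s
    generalize ecc x = e at *
    generalize eta x = η at *
    have h2 : e ^ 2 = 1 - η ^ 2 := by linarith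
    have h4 : e ^ 4 = (1 - η ^ 2) ^ 2 := by
      rw [← h2]
      ring
    field_simp
    rw [h2, h4]
    ring
  all_goals exact Continuous.intervalIntegrable (by fun_prop) _ _

/-! ### The trigonometric series -/

/-- The polynomial in `η` that multiplies a harmonic of the series. -/
def rowSum (s η : ℝ) (i : ℕ) (j : ℤ) : ℝ :=
  ∑ k ∈ Finset.range (6 - (j - 2 * (i : ℤ)).natAbs + 1), inclCoeff s i j k * η ^ k

theorem rowSum_zero_0 (s η : ℝ) :
    rowSum s η 0 0 =
      (462 * A060 s) + (-630 * A060 s) * η ^ 2 + (10 * A033 s) * η ^ 3 + (210 * A060 s) * η ^ 4 +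
      (24 * (71 * s ^ 4 - 128 * s ^ 2 + 56)) * η ^ 5 + (-4 * (63 * s ^ 4 - 24 * s ^ 2 + 8)) * η ^
      6 := by
  simp [rowSum, Finset.sum_range_succ, inclCoeff, coeffA, rowA]

theorem rowSum_zero_1 (s η : ℝ) :
    rowSum s η 0 1 =
      (792 * A060 s) + (-720 * A060 s) * η ^ 2 + (15 * A033 s) * η ^ 3 + (120 * A060 s) * η ^ 4 +
      (-3 * A033 s) * η ^ 5 := by
  simp [rowSum, Finset.sum_range_succ, inclCoeff, coeffA, rowA]

theorem rowSum_zero_2 (s η : ℝ) :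
    rowSum s η 0 2 =
      (495 * A060 s) + (-270 * A060 s) * η ^ 2 + (6 * A033 s) * η ^ 3 + (15 * A060 s) * η ^ 4 := by
  simp [rowSum, Finset.sum_range_succ, inclCoeff, coeffA, rowA]

theorem rowSum_zero_3 (s η : ℝ) :
    rowSum s η 0 3 =
      (220 * A060 s) + (-60 * A060 s) * η ^ 2 + (A033 s) * η ^ 3 := by
  simp [rowSum, Finset.sum_range_succ, inclCoeff, coeffA, rowA]

theorem rowSum_zero_4 (s η : ℝ) :
    rowSum s η 0 4 =
      (66 * A060 s) + (-6 * A060 s) * η ^ 2 := by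
  simp [rowSum, Finset.sum_range_succ, inclCoeff, coeffA, rowA]

theorem rowSum_zero_5 (s η : ℝ) :
    rowSum s η 0 5 =
      (12 * A060 s) := by
  simp [rowSum, Finset.sum_range_succ, inclCoeff, coeffA, rowA]

theorem rowSum_zero_6 (s η : ℝ) :
    rowSum s η 0 6 =
      (A060 s) := by
  simp [rowSum, inclCoeff, coeffA, rowA]

theorem rowSum_one_neg_4 (s η : ℝ) :
    rowSum s η 1 (-4) =
      (3 * s ^ 2 - 2) * (-12) := by
  simp [rowSum, inclCoeff, coeffA, rowA]

theorem rowSum_one_neg_3 (s η : ℝ) :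
    rowSum s η 1 (-3) =
      (3 * s ^ 2 - 2) * (-144) := by
  simp [rowSum, Finset.sum_range_succ, inclCoeff, coeffA, rowA]

theorem rowSum_one_neg_2 (s η : ℝ) :
    rowSum s η 1 (-2) =
      (3 * s ^ 2 - 2) * (-792) + (3 * s ^ 2 - 2) * (72) * η ^ 2 := by
  simp [rowSum, Finset.sum_range_succ, inclCoeff, coeffA, rowA]

theorem rowSum_one_neg_1 (s η : ℝ) :
    rowSum s η 1 (-1) =
      (3 * s ^ 2 - 2) * (-2640) + (3 * s ^ 2 - 2) * (720) * η ^ 2 + (3 * s ^ 2 - 2) * (24) * η ^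
      3 := by
  simp [rowSum, Finset.sum_range_succ, inclCoeff, coeffA, rowA]

theorem rowSum_one_0 (s η : ℝ) :
    rowSum s η 1 0 =
      (3 * s ^ 2 - 2) * (-5940) + (3 * s ^ 2 - 2) * (3240) * η ^ 2 + (3 * s ^ 2 - 2) * (144) * η
      ^ 3 + (3 * s ^ 2 - 2) * (-180) * η ^ 4 := by
  simp [rowSum, Finset.sum_range_succ, inclCoeff, coeffA, rowA]

theorem rowSum_one_1 (s η : ℝ) :
    rowSum s η 1 1 =
      (3 * s ^ 2 - 2) * (-9504) + (3 * s ^ 2 - 2) * (8640) * η ^ 2 + (3 * s ^ 2 - 2) * (360) * η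
      ^ 3 + (3 * s ^ 2 - 2) * (-1440) * η ^ 4 + (-(72 * (43 * s ^ 2 - 34))) * η ^ 5 := by
  simp [rowSum, Finset.sum_range_succ, inclCoeff, coeffA, rowA]

theorem rowSum_one_2 (s η : ℝ) :
    rowSum s η 1 2 =
      (3 * s ^ 2 - 2) * (-11088) + (3 * s ^ 2 - 2) * (15120) * η ^ 2 + (3 * s ^ 2 - 2) * (480) *
      η ^ 3 + (3 * s ^ 2 - 2) * (-5040) * η ^ 4 + (-(288 * (13 * s ^ 2 - 10))) * η ^ 5 + (3 * s ^
      2 - 2) * (240) * η ^ 6 := by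
  simp [rowSum, Finset.sum_range_succ, inclCoeff, coeffA, rowA]

theorem rowSum_one_3 (s η : ℝ) :
    rowSum s η 1 3 =
      (3 * s ^ 2 - 2) * (-9504) + (3 * s ^ 2 - 2) * (8640) * η ^ 2 + (3 * s ^ 2 - 2) * (360) * η
      ^ 3 + (3 * s ^ 2 - 2) * (-1440) * η ^ 4 + (-(24 * (49 * s ^ 2 - 38))) * η ^ 5 := by
  simp [rowSum, Finset.sum_range_succ, inclCoeff, coeffA, rowA]

theorem rowSum_one_4 (s η : ℝ) :
    rowSum s η 1 4 =
      (3 * s ^ 2 - 2) * (-5940) + (3 * s ^ 2 - 2) * (3240) * η ^ 2 + (3 * s ^ 2 - 2) * (144) * η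
      ^ 3 + (3 * s ^ 2 - 2) * (-180) * η ^ 4 := by
  simp [rowSum, Finset.sum_range_succ, inclCoeff, coeffA, rowA]

theorem rowSum_one_5 (s η : ℝ) :
    rowSum s η 1 5 =
      (3 * s ^ 2 - 2) * (-2640) + (3 * s ^ 2 - 2) * (720) * η ^ 2 + (3 * s ^ 2 - 2) * (24) * η ^
      3 := by
  simp [rowSum, Finset.sum_range_succ, inclCoeff, coeffA, rowA]

theorem rowSum_one_6 (s η : ℝ) :
    rowSum s η 1 6 =
      (3 * s ^ 2 - 2) * (-792) + (3 * s ^ 2 - 2) * (72) * η ^ 2 := by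
  simp [rowSum, Finset.sum_range_succ, inclCoeff, coeffA, rowA]

theorem rowSum_one_7 (s η : ℝ) :
    rowSum s η 1 7 =
      (3 * s ^ 2 - 2) * (-144) := by
  simp [rowSum, Finset.sum_range_succ, inclCoeff, coeffA, rowA]

theorem rowSum_one_8 (s η : ℝ) :
    rowSum s η 1 8 =
      (3 * s ^ 2 - 2) * (-12) := by
  simp [rowSum, inclCoeff, coeffA, rowA]

theorem rowSum_two_neg_2 (s η : ℝ) :
    rowSum s η 2 (-2) =
      (9) := by
  simp [rowSum, inclCoeff, coeffA, rowA]

theorem rowSum_two_neg_1 (s η : ℝ) :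
    rowSum s η 2 (-1) =
      (108) := by
  simp [rowSum, Finset.sum_range_succ, inclCoeff, coeffA, rowA]

theorem rowSum_two_0 (s η : ℝ) :
    rowSum s η 2 0 =
      (594) + (-54) * η ^ 2 := by
  simp [rowSum, Finset.sum_range_succ, inclCoeff, coeffA, rowA]

theorem rowSum_two_1 (s η : ℝ) :
    rowSum s η 2 1 =
      (1980) + (-540) * η ^ 2 := by
  simp [rowSum, Finset.sum_range_succ, inclCoeff, coeffA, rowA]

theorem rowSum_two_2 (s η : ℝ) :
    rowSum s η 2 2 =
      (4455) + (-2430) * η ^ 2 + (135) * η ^ 4 := by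
  simp [rowSum, Finset.sum_range_succ, inclCoeff, coeffA, rowA]

theorem rowSum_two_3 (s η : ℝ) :
    rowSum s η 2 3 =
      (7128) + (-6480) * η ^ 2 + (1080) * η ^ 4 := by
  simp [rowSum, Finset.sum_range_succ, inclCoeff, coeffA, rowA]

theorem rowSum_two_4 (s η : ℝ) :
    rowSum s η 2 4 =
      (8316) + (-11340) * η ^ 2 + (3780) * η ^ 4 + (-180) * η ^ 6 := by
  simp [rowSum, Finset.sum_range_succ, inclCoeff, coeffA, rowA]

theorem rowSum_two_5 (s η : ℝ) :
    rowSum s η 2 5 =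
      (7128) + (-6480) * η ^ 2 + (1080) * η ^ 4 := by
  simp [rowSum, Finset.sum_range_succ, inclCoeff, coeffA, rowA]

theorem rowSum_two_6 (s η : ℝ) :
    rowSum s η 2 6 =
      (4455) + (-2430) * η ^ 2 + (135) * η ^ 4 := by
  simp [rowSum, Finset.sum_range_succ, inclCoeff, coeffA, rowA]

theorem rowSum_two_7 (s η : ℝ) :
    rowSum s η 2 7 =
      (1980) + (-540) * η ^ 2 := by
  simp [rowSum, Finset.sum_range_succ, inclCoeff, coeffA, rowA]

theorem rowSum_two_8 (s η : ℝ) :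
    rowSum s η 2 8 =
      (594) + (-54) * η ^ 2 := by
  simp [rowSum, Finset.sum_range_succ, inclCoeff, coeffA, rowA]

theorem rowSum_two_9 (s η : ℝ) :
    rowSum s η 2 9 =
      (108) := by
  simp [rowSum, Finset.sum_range_succ, inclCoeff, coeffA, rowA]

theorem rowSum_two_10 (s η : ℝ) :
    rowSum s η 2 10 =
      (9) := by
  simp [rowSum, inclCoeff, coeffA, rowA]

/-- Each row is centered at j = 2i, in agreement with the exponent |j - 2i| of the eccentricity.
Only multiples of f and of 2f + 2g are then needed. -/
theorem cos_harmonic (f g : ℝ) (i : ℕ) (j : ℤ) :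
    cos (j * f + 2 * i * g) = cos (((j - 2 * i : ℤ) : ℝ) * f) * cos (i * (2 * f + 2 * g)) -
      sin (((j - 2 * i : ℤ) : ℝ) * f) * sin (i * (2 * f + 2 * g)) := by
  rw [← cos_add]
  congr 1
  push_cast
  ring

theorem smaSeries_eq (x : Delaunay) :
    smaSeries x = ∑ i ∈ Finset.range 3,
      ∑ j ∈ Finset.Icc (-(i : ℤ) - 3 * ((i % 2 : ℕ) : ℤ)) (6 + 2 * (i : ℤ)),
        sinI x ^ (2 * i) * rowSum (sinI x) (eta x) i j * ecc x ^ (j - 2 * (i : ℤ)).natAbs *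
          (cos (((j - 2 * i : ℤ) : ℝ) * anom x) * cos (i * (2 * anom x + 2 * x.g)) -
            sin (((j - 2 * i : ℤ) : ℝ) * anom x) * sin (i * (2 * anom x + 2 * x.g))) := by
  refine Finset.sum_congr rfl fun i _ => Finset.sum_congr rfl fun j _ => ?_
  rw [rowSum, Finset.mul_sum, Finset.sum_mul, Finset.sum_mul]
  refine Finset.sum_congr rfl fun k _ => ?_
  rw [cos_harmonic]
  ring

theorem sum_Icc_zero_six (F : ℤ → ℝ) :
    ∑ j ∈ Finset.Icc (0 : ℤ) 6, F j = F 0 + F 1 + F 2 + F 3 + F 4 + F 5 + F 6 := by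
  have h : Finset.Icc (0 : ℤ) 6 = {0, 1, 2, 3, 4, 5, 6} := rfl
  rw [h]
  simp [Finset.sum_insert]
  ring

theorem sum_Icc_neg_four_eight (F : ℤ → ℝ) :
    ∑ j ∈ Finset.Icc (-4 : ℤ) 8, F j = F (-4) + F (-3) + F (-2) + F (-1) + F 0 + F 1 + F 2 +
      F 3 + F 4 + F 5 + F 6 + F 7 + F 8 := by
  have h : Finset.Icc (-4 : ℤ) 8 = {-4, -3, -2, -1, 0, 1, 2, 3, 4, 5, 6, 7, 8} := rfl
  rw [h]
  simp [Finset.sum_insert]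
  ring

theorem sum_Icc_neg_two_ten (F : ℤ → ℝ) :
    ∑ j ∈ Finset.Icc (-2 : ℤ) 10, F j = F (-2) + F (-1) + F 0 + F 1 + F 2 + F 3 + F 4 +
      F 5 + F 6 + F 7 + F 8 + F 9 + F 10 := by
  have h : Finset.Icc (-2 : ℤ) 10 = {-2, -1, 0, 1, 2, 3, 4, 5, 6, 7, 8, 9, 10} := rfl
  rw [h]
  simp [Finset.sum_insert]
  ring

theorem cos_four_mul (f : ℝ) : cos (4 * f) = 8 * cos f ^ 4 - 8 * cos f ^ 2 + 1 := by
  rw [show 4 * f = 2 * (2 * f) by ring, cos_two_mul, cos_two_mul]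
  ring

theorem cos_six_mul (f : ℝ) :
    cos (6 * f) = 32 * cos f ^ 6 - 48 * cos f ^ 4 + 18 * cos f ^ 2 - 1 := by
  rw [show 6 * f = 2 * (3 * f) by ring, cos_two_mul, cos_three_mul]
  ring

theorem cos_five_mul (f : ℝ) : cos (5 * f) = 16 * cos f ^ 5 - 20 * cos f ^ 3 + 5 * cos f := by
  have h := cos_add_cos (6 * f) (4 * f)
  rw [show (6 * f + 4 * f) / 2 = 5 * f by ring, show (6 * f - 4 * f) / 2 = f by ring,
    cos_six_mul, cos_four_mul] at h
  have h1 : cos (5 * f) + cos (3 * f) = 2 * cos (4 * f) * cos f := by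
    rw [cos_add_cos]
    ring_nf
  rw [cos_four_mul, cos_three_mul] at h1
  linear_combination h1

/-- The trigonometric series in closed form. -/
theorem smaSeries_closed {x : Delaunay} (hx : x.Regular) (q : ℝ) :
    smaSeries x =
      128 * (6 * eta x ^ 3 * (1 - 3 / 2 * sinI x ^ 2) *
          (pot (anom x) (ecc x) x.g (sinI x ^ 2) - eta x ^ 3 * (1 - 3 / 2 * sinI x ^ 2)) +
        3 * eta x ^ 5 * (4 - 5 * sinI x ^ 2) * genG (anom x) (ecc x) x.g (sinI x ^ 2) q +
        4 * (pot (anom x) (ecc x) x.g (sinI x ^ 2) -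
          eta x ^ 3 * (1 - 3 / 2 * sinI x ^ 2)) ^ 2 -
        (eta x ^ 5 * (-6 + 27 / 2 * sinI x ^ 2 - 15 / 2 * sinI x ^ 4 +
            ecc x ^ 2 * (-3 / 2 + 3 / 2 * sinI x ^ 2 + 15 / 16 * sinI x ^ 4) +
            ecc x ^ 2 * cos (2 * x.g) * (sinI x ^ 2 * (21 / 4 - 45 / 8 * sinI x ^ 2) +
              6 * q * (5 * sinI x ^ 2 - 4))) -
          3 * eta x ^ 6 * (1 - 3 / 2 * sinI x ^ 2) ^ 2)) -
      24 * eta x ^ 7 * (5 * sinI x ^ 4 + 8 * sinI x ^ 2 - 8) -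
      48 * eta x ^ 5 * (15 * sinI x ^ 2 - 14) * sinI x ^ 2 * ecc x ^ 2 * cos (2 * x.g) := by
  have h0 : Finset.Icc (-((0 : ℕ) : ℤ) - 3 * ((0 % 2 : ℕ) : ℤ)) (6 + 2 * ((0 : ℕ) : ℤ)) =
    Finset.Icc 0 6 := rfl
  have h1 : Finset.Icc (-((0 + 1 : ℕ) : ℤ) - 3 * (((0 + 1) % 2 : ℕ) : ℤ))
    (6 + 2 * ((0 + 1 : ℕ) : ℤ)) = Finset.Icc (-4) 8 := rfl
  have h2 : Finset.Icc (-((0 + 1 + 1 : ℕ) : ℤ) - 3 * (((0 + 1 + 1) % 2 : ℕ) : ℤ))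
    (6 + 2 * ((0 + 1 + 1 : ℕ) : ℤ)) = Finset.Icc (-2) 10 := rfl
  rw [smaSeries_eq, Finset.sum_range_succ, Finset.sum_range_succ, Finset.sum_range_succ,
    Finset.sum_range_zero, h0, h1, h2, sum_Icc_zero_six, sum_Icc_neg_four_eight,
    sum_Icc_neg_two_ten]
  have hg : cos (2 * x.g) = cos (2 * anom x + 2 * x.g) * (2 * cos (anom x) ^ 2 - 1) +
      sin (2 * anom x + 2 * x.g) * (2 * sin (anom x) * cos (anom x)) := by
    rw [← cos_two_mul, ← sin_two_mul, ← cos_sub]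
    ring_nf
  simp
  simp only [
    rowSum_zero_0, rowSum_zero_1, rowSum_zero_2, rowSum_zero_3, rowSum_zero_4, rowSum_zero_5,
    rowSum_zero_6, rowSum_one_neg_4, rowSum_one_neg_3, rowSum_one_neg_2, rowSum_one_neg_1,
    rowSum_one_0, rowSum_one_1, rowSum_one_2, rowSum_one_3, rowSum_one_4, rowSum_one_5,
    rowSum_one_6, rowSum_one_7, rowSum_one_8, rowSum_two_neg_2, rowSum_two_neg_1, rowSum_two_0,
    rowSum_two_1, rowSum_two_2, rowSum_two_3, rowSum_two_4, rowSum_two_5, rowSum_two_6,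
    rowSum_two_7, rowSum_two_8, rowSum_two_9, rowSum_two_10]
  rw [hg]
  -- The rows are symmetric about j = 2i, so the products of sines cancel in pairs and need no
  -- expansion. The exception is j = 1, 3 for i = 1, whose different η⁵ entries leave sin f sin(2f +
  -- 2g), the sine term of `genG`.
  simp only [pot, genG, hg, cos_six_mul, cos_five_mul, cos_four_mul, cos_three_mul,
    cos_two_mul (anom x), cos_two_mul (2 * anom x + 2 * x.g), A060, A033]
  have hsq := eta_sq hx
  have h3 : eta x ^ 3 = eta x * (1 - ecc x ^ 2) := by rw [← hsq]; ring
  have h4 : eta x ^ 4 = (1 - ecc x ^ 2) ^ 2 := by rw [← hsq]; ring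
  have h5 : eta x ^ 5 = eta x * (1 - ecc x ^ 2) ^ 2 := by rw [← hsq]; ring
  have h6 : eta x ^ 6 = (1 - ecc x ^ 2) ^ 3 := by rw [← hsq]; ring
  have h7 : eta x ^ 7 = eta x * (1 - ecc x ^ 2) ^ 3 := by rw [← hsq]; ring
  generalize sin (2 * anom x + 2 * x.g) = v
  generalize cos (2 * anom x + 2 * x.g) = u
  generalize sin (anom x) = S
  generalize cos (anom x) = c
  generalize sinI x = s
  generalize ecc x = e at *
  generalize eta x = η at *
  -- Reduction modulo η² = 1 - e². Expanding the square of `pot` minus its average creates η² once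
  -- more, hence the second use of `hsq` below. The terms in q cancel for every q.
  simp only [hsq, h3, h4, h5, h6, h7]
  rw [← sub_eq_zero]
  ring_nf
  simp only [hsq]
  ring

/-! ### The corrections to the semi-major axis -/

theorem hasDerivAt_W2 {μ : ℝ} (hμ : 0 < μ) (R : ℝ) {C2 : Delaunay → ℝ}
    (hC2 : ∀ (y : Delaunay) (t : ℝ), C2 { y with ℓ := t } = C2 y) {x : Delaunay}
    (hx : x.Regular) (hc : 5 * sinI x ^ 2 ≠ 4) :
    HasDerivAt (fun t => W2 μ R C2 { x with ℓ := t })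
      ((Htilde02 μ R x - H02 μ R x) / meanMotion μ x) x.ℓ := by
  -- An average ignores the value of ℓ, so the second term is constant by definition, and the
  -- fundamental theorem of calculus needs only continuity in ℓ.
  have hcont : Continuous fun t => Htilde02 μ R { x with ℓ := t } - H02 μ R { x with ℓ := t } :=
    (continuous_Htilde02 hμ R hx hc).fun_sub (continuous_const (y := H02 μ R x))
  have h := ((hcont.integral_hasStrictDerivAt 0 x.ℓ).hasDerivAt.const_mul
    (1 / meanMotion μ x)).add_const (C2 x)
  refine (h.congr_of_eventuallyEq (Eventually.of_forall fun t => ?_)).congr_deriv ?_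
  · simp only [W2, V2, hC2]
    rfl
  · ring

theorem hasGradient_sma (μ : ℝ) (x : Delaunay) :
    HasGradient (sma μ) ⟨0, 0, 0, 2 * x.L / μ, 0, 0⟩ x := by
  rintro X X' t hX rfl
  refine ((hX.L.pow 2).div_const μ).congr_deriv ?_
  norm_num
  ring

/-- All partial derivatives of a except that in L are zero, so those of B in the other variables are
multiplied by zero whether or not they exist. Hence 𝒞₂ may be arbitrary in everything but ℓ. -/
theorem poisson_sma (μ : ℝ) (B : Delaunay → ℝ) (x : Delaunay) :
    poisson (sma μ) B x = -(2 * x.L / μ) * dℓ B x := by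
  have h := hasGradient_sma μ x
  rw [poisson, show dℓ (sma μ) x = _ from h.hasDerivAt_ℓ.deriv,
    show dg (sma μ) x = _ from h.hasDerivAt_g.deriv,
    show dh (sma μ) x = _ from h.hasDerivAt_h.deriv,
    show dL (sma μ) x = _ from h.hasDerivAt_L.deriv,
    show dG (sma μ) x = _ from h.hasDerivAt_G.deriv,
    show dH (sma μ) x = _ from h.hasDerivAt_H.deriv]
  ring

theorem Delta_sma {μ : ℝ} (hμ : 0 < μ) (R : ℝ) {x : Delaunay} (hx : x.Regular)
    (hc : 5 * sinI x ^ 2 ≠ 4) :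
    Delta μ R (sma μ) x = -(2 / μ ^ 3) * (x.L ^ 4 * (H10 μ R x - H01 μ R x)) := by
  have hL := hx.L_pos.ne'
  rw [Delta, poisson_sma, dℓ, (hasGradient_W1 hμ R hx hc).hasDerivAt_ℓ.deriv,
    gradW1_ℓ hμ R hx, meanMotion]
  field_simp

/-- The partial derivatives of `Δa`. -/
def gradDelta (μ R : ℝ) (x : Delaunay) : Delaunay where
  ℓ := -(2 / μ ^ 3) * (x.L ^ 4 * ((gradH10 μ R x).ℓ - (gradH01 μ R x).ℓ))
  g := -(2 / μ ^ 3) * (x.L ^ 4 * ((gradH10 μ R x).g - (gradH01 μ R x).g))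
  h := -(2 / μ ^ 3) * (x.L ^ 4 * ((gradH10 μ R x).h - (gradH01 μ R x).h))
  L := -(2 / μ ^ 3) * (x.L ^ 4 * ((gradH10 μ R x).L - (gradH01 μ R x).L) +
    4 * x.L ^ 3 * (H10 μ R x - H01 μ R x))
  G := -(2 / μ ^ 3) * (x.L ^ 4 * ((gradH10 μ R x).G - (gradH01 μ R x).G))
  H := -(2 / μ ^ 3) * (x.L ^ 4 * ((gradH10 μ R x).H - (gradH01 μ R x).H))

theorem hasGradient_Delta {μ : ℝ} (hμ : 0 < μ) (R : ℝ) {x : Delaunay} (hx : x.Regular)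
    (hc : 5 * sinI x ^ 2 ≠ 4) : HasGradient (Delta μ R (sma μ)) (gradDelta μ R x) x := by
  rintro X X' t hX rfl
  have h := ((hX.L.pow 4).mul ((hasGradient_H10 hμ R hx hX rfl).sub
    (hasGradient_H01 hμ R hx hX rfl))).const_mul (-(2 / μ ^ 3))
  refine (h.congr_of_eventuallyEq (((hX.eventually_regular hx).and
    (hX.eventually_noncritical hx hc)).mono fun τ hτ => ?_)).congr_deriv ?_
  · exact Delta_sma hμ R hτ.1 hτ.2
  · simp only [gradDelta, Pi.pow_apply, Pi.sub_apply]
    push_cast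
    ring

/-- The bracket {ℋ₁₀, 𝒲₁} occurs with opposite signs in the two parts of δa, while {ℋ₀₁, 𝒲₁}
doubles. The square comes from the factor L⁴ of Δa, since {L⁴, 𝒲₁} = -4L³ ∂𝒲₁/∂ℓ. -/
theorem invDelta_sma {μ : ℝ} (hμ : 0 < μ) (R : ℝ) {C2 : Delaunay → ℝ}
    (hC2 : ∀ (y : Delaunay) (t : ℝ), C2 { y with ℓ := t } = C2 y) {x : Delaunay}
    (hx : x.Regular) (hc : 5 * sinI x ^ 2 ≠ 4) :
    invDelta μ R C2 (sma μ) x =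
      2 * x.L ^ 3 / μ ^ 3 * (4 * (H10 μ R x - H01 μ R x) ^ 2 / meanMotion μ x -
        2 * x.L * ((gradH01 μ R x).L * (H10 μ R x - H01 μ R x) / meanMotion μ x +
          (gradH01 μ R x).G * (gradW1 μ R x).g) - x.L * H02 μ R x) := by
  have hL := hx.L_pos.ne'
  rw [invDelta, (hasGradient_Delta hμ R hx hc).poisson_eq (hasGradient_W1 hμ R hx hc),
    poisson_sma, dℓ, (hasDerivAt_W2 hμ R hC2 hx hc).deriv, Htilde02_eq hμ R hx hc,
    gradW1_ℓ hμ R hx]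
  simp only [gradDelta, show (gradH01 μ R x).g = 0 from rfl, show (gradH01 μ R x).ℓ = 0 from rfl,
    show (gradH01 μ R x).h = 0 from rfl, show (gradH10 μ R x).h = 0 from rfl,
    show (gradW1 μ R x).h = 0 from rfl, meanMotion]
  field_simp
  ring

end

end Brouwer

/-! ### The homological equations and the second-order correction -/

theorem mainTheorem3 (μ R : ℝ) (hμ : 0 < μ)
    (C2 : Brouwer.Delaunay → ℝ)
    (hC2 : ∀ (y : Brouwer.Delaunay) (t : ℝ), C2 { y with ℓ := t } = C2 y)
    (x : Brouwer.Delaunay) (hx : x.Regular) (hcrit : 5 * Brouwer.sinI x ^ 2 ≠ 4) :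
    -- the determining function solves the homological equations of the first two orders
    HasDerivAt (fun t => Brouwer.W1 μ R { x with ℓ := t })
      ((Brouwer.H10 μ R x - Brouwer.H01 μ R x) / Brouwer.meanMotion μ x) x.ℓ ∧
    HasDerivAt (fun t => Brouwer.W2 μ R C2 { x with ℓ := t })
      ((Brouwer.Htilde02 μ R x - Brouwer.H02 μ R x) / Brouwer.meanMotion μ x) x.ℓ ∧
    -- the derivatives in the Poisson bracket of `Δa` and `𝒲₁` exist
    Brouwer.HasPartials (Brouwer.W1 μ R) x ∧
    Brouwer.HasPartials (Brouwer.Delta μ R (Brouwer.sma μ)) x ∧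
    -- the inverse second order correction to the semi-major axis
    Brouwer.invDelta μ R C2 (Brouwer.sma μ) x =
      Brouwer.sma μ x * (R ^ 4 / Brouwer.param μ x ^ 4) * (1 / (4 ^ 4 * Brouwer.eta x ^ 4)) *
        (24 * Brouwer.eta x ^ 7 *
            (5 * Brouwer.sinI x ^ 4 + 8 * Brouwer.sinI x ^ 2 - 8) +
          48 * Brouwer.eta x ^ 5 * (15 * Brouwer.sinI x ^ 2 - 14) * Brouwer.sinI x ^ 2 *
            Brouwer.ecc x ^ 2 * Real.cos (2 * x.g) +
          Brouwer.smaSeries x) := by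
  have hW := Brouwer.hasGradient_W1 hμ R hx hcrit
  refine ⟨?_, Brouwer.hasDerivAt_W2 hμ R hC2 hx hcrit, hW.hasPartials,
    (Brouwer.hasGradient_Delta hμ R hx hcrit).hasPartials, ?_⟩
  · rw [← Brouwer.gradW1_ℓ hμ R hx]
    exact hW.hasDerivAt_ℓ
  · have hL := hx.L_pos.ne'
    have hη := (Brouwer.eta_pos hx).ne'
    have hG : x.G = Brouwer.eta x * x.L := by
      rw [Brouwer.eta_eq hx]
      field_simp
    -- The free parameter of `smaSeries_closed` is set to the actual coefficient of the integration
    -- constant, so that its closed form matches the terms of ∂𝒲₁/∂g and ℋ₀₂ literally.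
    rw [Brouwer.invDelta_sma hμ R hC2 hx hcrit, Brouwer.H02_eq hμ R hx hcrit,
      Brouwer.smaSeries_closed hx (Brouwer.constCoeff (Brouwer.sinI x ^ 2)),
      Brouwer.H10_eq hμ R hx, Brouwer.H01_eq hμ R hx, Brouwer.param_eq hμ hx, Brouwer.sma]
    simp only [Brouwer.gradH01, Brouwer.gradW1, Brouwer.sinSqG, Brouwer.meanMotion, hG]
    field_simp
    ring
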